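/- Conventions. A partition $\lambda$ is a weakly decreasing sequence of non-negative integers with finitely many positive entries, of size $|\lambda|$, with $\ell(\lambda)$ positive entries and conjugate $\lambda'$. For $S\subseteq[n]=\{1,\dots,n\}$ let $e_d(S)$ be the elementary symmetric polynomial of degree $d$ in the variables $x_i$, $i\in S$, and let $p^n_m(\lambda)=\lambda'_{n-m+1}+\lambda'_{n-m+2}+\cdots$ for $m\le n$. For a commutative ring $R$ consider the ideal of $R[x_1,\dots,x_n]$ generated by all $e_d(S)$ with $S\subseteq[n]$, $d\ge 0$ and $d>|S|-p^n_{|S|}(\lambda)$; it is denoted $I_{n,\lambda,\infty}$ for $R=\mathbb Q$ and $J_{n,\lambda}$ for $R=\mathbb Z$. For a finite $s\ge\ell(\lambda)$, $I_{n,\lambda,s}=I_{n,\lambda,\infty}+\langle x_1^s,\dots,x_n^s\rangle$. The graded reverse lexicographic order is: $x^a<x^b$ if $\deg x^a<\deg x^b$, or the degrees are equal and at the least $i$ with $a_i\ne b_i$ one has $a_i>b_i$. A finite set $G\subseteq I$ is a Gröbner basis of an ideal $I$ if the leading monomials of the nonzero elements of $G$ generate the same ideal as those of the nonzero elements of $I$.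 Container diagrams. A container diagram of $(n,\lambda)$ is the Young diagram of $\lambda'$ (row 1 on top, column 1 leftmost) together with the numbers of $[n]$, each used once, placed either in a box or floating above the diagram in some column (also possibly a column without boxes), such that each box contains at most one number, no number lies above an empty box in the same column, and each column is decreasing from top to bottom. Empty boxes count as containing $\infty$. The code $(\alpha_1,\dots,\alpha_n)$ of the diagram is: if $i$ is in a box of row $r$, $\alpha_i$ is the number of boxes, in row $r$ to the right of $i$ or in row $r+1$ to the left of $i$, that contain a number larger than $i$; if $i$ floats in column $c$, $\alpha_i$ is $c-1$ plus the number of boxes in row 1 to the right of column $c$ that contain a number larger than $i$. Let $\mathcal D_{n,\lambda}$ be the set of codes of the container diagrams such that (1) exactly one box is empty; (2) the numbers in the boxes of each row decrease from left to right, and the box in row 1, column 1 is empty; (3) if $i$ floats, then every column to its left has a box that is empty or contains a number larger than $i$. Construction. For $j\ge1$ let $\lambda^{(j)}$ be the partition whose conjugate is $\lambda'$ with its $j$-th entry decreased by $1$, if this is a partition; let $\lambda^{(0)}=\lambda$. For $n\ge1$, $1\le|\lambda|\le n+1$ and $\alpha\in\mathcal D_{n,\lambda}$ define $F_{n,\lambda,\alpha}\in\mathbb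 Z[x_1,\dots,x_n]$ recursively. If $n=1$, then $F_{n,\lambda,\alpha}=x_1$ for $|\lambda|=1$ and $F_{n,\lambda,\alpha}=1$ for $|\lambda|=2$. If $n>1$, take $j\ge0$ ($j\ne0$ if $|\lambda|=n+1$) such that $\lambda^{(j)}$ is defined, $\alpha_1=\lambda'_{j+1}=:a$ and $\beta:=(\alpha_2,\dots,\alpha_n)\in\mathcal D_{n-1,\lambda^{(j)}}$. Let $\tilde f$ be obtained from $F_{n-1,\lambda^{(j)},\beta}$ by replacing each $x_i$ by $x_{i+1}$. Write $\tilde f=\sum_{d,S} g_{d,S}\,e_d(S)$, a finite sum over pairs with $S\subseteq\{2,\dots,n\}$, $d\ge0$ and $d>|S|-p^{n-1}_{|S|}(\lambda^{(j)})$, where $g_{d,S}\in\mathbb Z[x_2,\dots,x_n]$ is homogeneous of degree $\beta_1+\dots+\beta_{n-1}-d$ (only pairs for which this degree is non-negative occur). Set $F_{n,\lambda,\alpha}=\sum_{d,S} g_{d,S}F_{d,S}$, where $F_{d,S}=x_1^a e_d(S\sqcup\{1\})$ if $|S|\ge n-j$ and $F_{d,S}=x_1^a e_d(S)$ if $|S|<n-j$.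 Let $G_{n,\lambda}=\{F_{n,\lambda,\alpha}:\alpha\in\mathcal D_{n,\lambda}\}$. Theorem. The construction can be carried out: there is a family $(F_{n,\lambda,\alpha})$, indexed by all $n\ge1$, all $\lambda$ with $1\le|\lambda|\le n+1$ and all $\alpha\in\mathcal D_{n,\lambda}$, that arises in this way. For every such family (whatever coefficients $g_{d,S}$ were chosen), every $n\ge1$ and every partition $\lambda$ with $1\le|\lambda|\le n+1$: 1. $\mathcal D_{n,\lambda}$ is finite, and for each $\alpha\in\mathcal D_{n,\lambda}$ the polynomial $F_{n,\lambda,\alpha}$ has integer coefficients, lies in $J_{n,\lambda}$ (hence in $I_{n,\lambda,\infty}$), is homogeneous, and has leading monomial $x^\alpha=x_1^{\alpha_1}\cdots x_n^{\alpha_n}$ and leading coefficient $1$ for the graded reverse lexicographic order. 2. $G_{n,\lambda}$ is a Gröbner basis of $I_{n,\lambda,\infty}$ for the graded reverse lexicographic order. 3. For every finite $s\ge\ell(\lambda)$, $G_{n,\lambda}\cup\{x_1^s,\dots,x_n^s\}$ is a Gröbner basis of $I_{n,\lambda,s}$ for the graded reverse lexicographic order. -/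

import Mathlib

namespace Griffin

open MvPolynomial

/-! ### The graded reverse lexicographic order

Variables `x₁, …, xₙ` are `X 0, …, X (n-1)`; the exponent vector of a monomial is an element of
`Fin n →₀ ℕ`. -/

/-- Exponent vectors of monomials in `n` variables, to be ordered by the graded reverse
lexicographic order. -/
def Grevlex (n : ℕ) : Type := Fin n →₀ ℕ

noncomputable instance (n : ℕ) : AddCommMonoid (Grevlex n) :=
  inferInstanceAs (AddCommMonoid (Fin n →₀ ℕ))

/-- The identity map. -/
noncomputable def toGrevlex (n : ℕ) : (Fin n →₀ ℕ) ≃+ Grevlex n where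
  toFun a := a
  invFun a := a
  left_inv _ := rfl
  right_inv _ := rfl
  map_add' _ _ := rfl

/-- Compare degrees first; for equal degrees compare lexicographically (the least index at which
the exponents differ decides), with the outcome reversed. -/
noncomputable def grevlexKey (n : ℕ) (a : Grevlex n) : Lex (ℕ × (Lex (Fin n →₀ ℕ))ᵒᵈ) :=
  toLex (((toGrevlex n).symm a).degree, OrderDual.toDual (toLex ((toGrevlex n).symm a)))

theorem grevlexKey_injective (n : ℕ) : Function.Injective (grevlexKey n) := by
  intro a b h
  have h2 : OrderDual.toDual (toLex ((toGrevlex n).symm a))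
      = OrderDual.toDual (toLex ((toGrevlex n).symm b)) := congrArg (fun z => (ofLex z).2) h
  exact (toGrevlex n).symm.injective (toLex.injective (OrderDual.toDual.injective h2))

noncomputable instance (n : ℕ) : LinearOrder (Grevlex n) :=
  LinearOrder.lift' (grevlexKey n) (grevlexKey_injective n)

theorem grevlex_le_def {n : ℕ} (a b : Fin n →₀ ℕ) :
    toGrevlex n a ≤ toGrevlex n b ↔
      a.degree < b.degree ∨ (a.degree = b.degree ∧ toLex b ≤ toLex a) :=
  Prod.Lex.le_iff

theorem grevlex_lt_def {n : ℕ} (a b : Fin n →₀ ℕ) :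
    toGrevlex n a < toGrevlex n b ↔
      a.degree < b.degree ∨ (a.degree = b.degree ∧ toLex b < toLex a) :=
  Prod.Lex.lt_iff

theorem grevlex_mono {n : ℕ} : Monotone (toGrevlex n) := by
  intro a b h
  obtain ⟨c, rfl⟩ := exists_add_of_le h
  rw [grevlex_le_def]
  by_cases hc : c.degree = 0
  · right
    rw [Finsupp.degree_eq_zero_iff] at hc
    simp [hc]
  · left
    rw [map_add]
    omega

instance (n : ℕ) : IsOrderedAddMonoid (Grevlex n) where
  add_le_add_left a b h c := by
    obtain ⟨a, rfl⟩ := (toGrevlex n).surjective a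
    obtain ⟨b, rfl⟩ := (toGrevlex n).surjective b
    obtain ⟨c, rfl⟩ := (toGrevlex n).surjective c
    rw [grevlex_le_def] at h
    rw [← map_add, ← map_add, grevlex_le_def, map_add, map_add]
    rcases h with h | ⟨h1, h2⟩
    · left; omega
    · right
      refine ⟨by omega, ?_⟩
      rw [toLex_add, toLex_add]
      exact add_le_add_left h2 _

instance (n : ℕ) : WellFoundedLT (Grevlex n) := by
  have := Monotone.wellQuasiOrderedLE_of_wellQuasiOrderedLE_of_surjective
    (grevlex_mono (n := n)) (toGrevlex n).surjective
  exact WellQuasiOrderedLE.to_wellFoundedLT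

/-- The graded reverse lexicographic order on the monomials in `x₁, …, xₙ`. -/
noncomputable def grevlex (n : ℕ) : MonomialOrder (Fin n) where
  syn := Grevlex n
  toSyn := toGrevlex n
  toSyn_monotone := grevlex_mono

open scoped MonomialOrder in
theorem grevlex_lt_iff {n : ℕ} (a b : Fin n →₀ ℕ) :
    a ≺[grevlex n] b ↔ a.degree < b.degree ∨
      (a.degree = b.degree ∧ ∃ i, (∀ j < i, a j = b j) ∧ b i < a i) := by
  refine (grevlex_lt_def a b).trans ?_
  rw [Finsupp.Lex.lt_iff]
  simp only [ofLex_toLex, eq_comm]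

/-! ### Initial ideals and Gröbner bases -/

/-- The ideal generated by the leading monomials `in_<(f)` of the nonzero `f ∈ A`. -/
noncomputable def leadingIdeal {σ K : Type*} [Field K] (m : MonomialOrder σ)
    (A : Set (MvPolynomial σ K)) : Ideal (MvPolynomial σ K) :=
  Ideal.span {p | ∃ f ∈ A, f ≠ 0 ∧ p = monomial (m.degree f) 1}

/-- `A` is a Gröbner basis of `I`: a finite subset of `I` whose leading monomials generate the
initial ideal of `I`. -/
def IsGroebnerBasis {σ K : Type*} [Field K] (m : MonomialOrder σ)
    (A : Set (MvPolynomial σ K)) (I : Ideal (MvPolynomial σ K)) : Prop :=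
  A.Finite ∧ A ⊆ I ∧ leadingIdeal m A = leadingIdeal m (I : Set (MvPolynomial σ K))

/-! ### Griffin's ideals

A partition `λ` is a `YoungDiagram`: `λ_{i+1} = lam.rowLen i`, `λ'_{i+1} = lam.colLen i`,
`|λ| = lam.card` and `ℓ(λ) = lam.colLen 0`. -/

/-- `e_d(S)`, the elementary symmetric polynomial of degree `d` in the variables indexed by `S`. -/
noncomputable def e (R : Type*) [CommRing R] {n : ℕ} (d : ℕ) (S : Finset (Fin n)) :
    MvPolynomial (Fin n) R :=
  ∑ t ∈ S.powersetCard d, ∏ i ∈ t, X i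

/-- `p_m^n(λ) = λ'_{n-m+1} + λ'_{n-m+2} + ⋯`, for `m ≤ n`. The terms beyond `λ'_{λ₁}` vanish. -/
def pSum (n m : ℕ) (lam : YoungDiagram) : ℕ :=
  ∑ i ∈ Finset.Ico (n - m) (lam.rowLen 0), lam.colLen i

/-- The condition `d > |S| - p_{|S|}^n(λ)` on the generators `e_d(S)`, as an inequality of
integers. -/
def IsGeneratorIndex (n : ℕ) (lam : YoungDiagram) (d : ℕ) (S : Finset (Fin n)) : Prop :=
  (S.card : ℤ) - (pSum n S.card lam : ℤ) < (d : ℤ)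

/-- The ideal of `R[x₁, …, xₙ]` generated by the `e_d(S)` with `S ⊆ [n]` and
`d > |S| - p_{|S|}^n(λ)` and, if `s` is finite, by `x₁^s, …, xₙ^s`.
For `R = ℚ` this is `I_{n,λ,s}`. For `R = ℤ` and `s = ∞` this is `J_{n,λ}`. -/
noncomputable def griffinIdeal (R : Type*) [CommRing R] (n : ℕ) (lam : YoungDiagram) (s : ℕ∞) :
    Ideal (MvPolynomial (Fin n) R) :=
  Ideal.span ({f | ∃ d S, IsGeneratorIndex n lam d S ∧ f = e R d S} ∪
    {f | ∃ (k : ℕ) (i : Fin n), s = k ∧ f = X i ^ k})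

/-! ### Container diagrams and coinversion codes

Boxes are pairs `(r, c)` (row, column) of the Young diagram of the conjugate `λ'`, counted from
`0`, with row `0` on top and column `0` leftmost. The number `i + 1 ∈ [n]` is the element `i` of
`Fin n`. -/

/-- A container diagram of `(n, λ)`: a filling of the Young diagram of `λ'` by the numbers of
`[n]`, each of which is either in a box or floats above the diagram in some column. -/
structure ContainerDiagram (n : ℕ) (lam : YoungDiagram) where
  /-- The column of a number. -/
  col : Fin n → ℕ
  /-- The row of a number; `none` if the number floats. -/
  row : Fin n → Option ℕ
  /-- A number that does not float is in a box of the diagram. -/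
  mem_box : ∀ i r, row i = some r → (r, col i) ∈ lam.transpose
  /-- Every box contains at most one number. -/
  box_unique : ∀ i k r, row i = some r → row k = some r → col i = col k → i = k
  /-- An empty box has no number above it in its column: every number of the column is in a
  lower box. -/
  below_empty : ∀ r c, (r, c) ∈ lam.transpose → (∀ k, ¬ (row k = some r ∧ col k = c)) →
    ∀ i, col i = c → ∃ r', row i = some r' ∧ r < r'
  /-- The numbers in the boxes of a column are decreasing from top to bottom. -/
  box_decreasing : ∀ i k r r', row i = some r → row k = some r' → col i = col k → r < r' → k < i
  /-- A floating number is larger than all numbers in the boxes of its column. (The floating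
  numbers of a column are listed decreasingly, so their set determines their arrangement.) -/
  float_decreasing : ∀ i k r, row i = none → row k = some r → col i = col k → k < i

namespace ContainerDiagram

variable {n : ℕ} {lam : YoungDiagram} (σ : ContainerDiagram n lam)

/-- The number `i` is in the box `b`. -/
def InBox (i : Fin n) (b : ℕ × ℕ) : Prop := σ.row i = some b.1 ∧ σ.col i = b.2

/-- `b` is an empty box of the Young diagram. -/
def IsEmptyBox (b : ℕ × ℕ) : Prop := b ∈ lam.transpose ∧ ∀ k, ¬ σ.InBox k b

/-- The box `b` contains a number larger than `i`, where empty boxes contain `∞`. -/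
def Larger (i : Fin n) (b : ℕ × ℕ) : Prop := ∀ k, σ.InBox k b → i < k

open Classical in
/-- The coinversion code. For `i` in a box of row `r`, count the boxes in row `r` to the right of
`i` or in row `r + 1` to the left of `i` that contain a number larger than `i`. For `i` floating
in column `c` (counted from `0`), the entry is `c` plus the number of boxes in the top row to the
right of column `c` that contain a number larger than `i`. -/
noncomputable def code (i : Fin n) : ℕ :=
  match σ.row i with
  | some r => (lam.transpose.cells.filter fun b =>
      ((b.1 = r ∧ σ.col i < b.2) ∨ (b.1 = r + 1 ∧ b.2 < σ.col i)) ∧ σ.Larger i b).card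
  | none => σ.col i + (lam.transpose.cells.filter fun b =>
      (b.1 = 0 ∧ σ.col i < b.2) ∧ σ.Larger i b).card

/-- There is exactly one empty box. -/
def Condition1 : Prop := ∃! b, σ.IsEmptyBox b

/-- The filling of the boxes is decreasing in each row from left to right, and the box in the
first row and first column is empty. -/
def Condition2 : Prop :=
  (∀ i k r, σ.row i = some r → σ.row k = some r → σ.col i < σ.col k → k < i) ∧
    σ.IsEmptyBox (0, 0)

/-- If `i` floats, every column to its left has a box that is empty or contains a number larger
than `i`. -/
def Condition3 : Prop :=
  ∀ i, σ.row i = none → ∀ c < σ.col i, ∃ r, (r, c) ∈ lam.transpose ∧ σ.Larger i (r, c)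

end ContainerDiagram

/-- `D_{n,λ}`: the codes of the container diagrams of `(n, λ)` that satisfy the three
conditions. -/
def codeSet (n : ℕ) (lam : YoungDiagram) : Set (Fin n → ℕ) :=
  {α | ∃ σ : ContainerDiagram n lam, σ.Condition1 ∧ σ.Condition2 ∧ σ.Condition3 ∧ σ.code = α}

/-! ### The recursive construction -/

/-- `λ^{(j)}` is defined and equal to `μ`: the conjugate of `μ` is obtained from `λ'` by decreasing
its `j`-th entry (counted from `1`) by `1`; for `j = 0` nothing is changed. -/
def IsLowered (lam : YoungDiagram) (j : ℕ) (mu : YoungDiagram) : Prop :=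
  ∀ i, lam.colLen i = mu.colLen i + if i + 1 = j then 1 else 0

/-- The polynomial `F_{d,S}` in `x₁, …, x_{n+1}`, where `a = λ'_{j+1}` and `S ⊆ {2, …, n+1}` is the
shift of a subset `S` of `[n]`: it is `x₁^a e_d(S ⊔ {1})` if `|S| ≥ (n + 1) - j`, and
`x₁^a e_d(S)` otherwise. -/
noncomputable def liftedGenerator (n : ℕ) (lam : YoungDiagram) (j d : ℕ) (S : Finset (Fin n)) :
    MvPolynomial (Fin (n + 1)) ℤ :=
  X 0 ^ lam.colLen j *
    if n + 1 ≤ S.card + j then e ℤ d (insert 0 (S.map (Fin.succEmb n)))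
    else e ℤ d (S.map (Fin.succEmb n))

/-- One step of the construction, from `f` in `n` variables with exponent vector `β` of degree `D`
to `F` in `n + 1` variables: write `f = ∑ g_{d,S} e_d(S)` over finitely many generators `e_d(S)`
of `J_{n,λ^{(j)}}`, with `g_{d,S}` homogeneous of degree `D - d`, and set
`F = ∑ g̃_{d,S} F_{d,S}`, where `g̃` is obtained from `g` by shifting `x_i` to `x_{i+1}`. -/
def IsLift (n : ℕ) (lam : YoungDiagram) (j : ℕ) (mu : YoungDiagram) (D : ℕ)
    (f : MvPolynomial (Fin n) ℤ) (F : MvPolynomial (Fin (n + 1)) ℤ) : Prop :=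
  ∃ (T : Finset (ℕ × Finset (Fin n))) (g : ℕ × Finset (Fin n) → MvPolynomial (Fin n) ℤ),
    (∀ t ∈ T, IsGeneratorIndex n mu t.1 t.2 ∧ ∃ k, k + t.1 = D ∧ (g t).IsHomogeneous k) ∧
    f = ∑ t ∈ T, g t * e ℤ t.1 t.2 ∧
    F = ∑ t ∈ T, rename Fin.succ (g t) * liftedGenerator n lam j t.1 t.2

/-- `G n λ α`, for `n ≥ 1`, `1 ≤ |λ| ≤ n + 1` and `α ∈ D_{n,λ}`, is a family of polynomials
produced by the recursive construction, for some choice in each step of the coefficients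
`g_{d,S}`. Values of `G` at other arguments are irrelevant. -/
structure IsRecursiveFamily
    (G : (n : ℕ) → YoungDiagram → (Fin n → ℕ) → MvPolynomial (Fin n) ℤ) : Prop where
  /-- `G_{1,(1)} = {x₁}`. -/
  base_one : ∀ lam : YoungDiagram, lam.card = 1 → ∀ α ∈ codeSet 1 lam, G 1 lam α = X 0
  /-- `G_{1,(2)} = G_{1,(1,1)} = {1}`. -/
  base_two : ∀ lam : YoungDiagram, lam.card = 2 → ∀ α ∈ codeSet 1 lam, G 1 lam α = 1
  /-- The recursive step from `n` to `n + 1` variables. For `α ∈ D_{n+1,λ}` take `j` such that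
  `λ^{(j)}` is defined, `α₁ = λ'_{j+1}` and `(α₂, …, α_{n+1}) ∈ D_{n,λ^{(j)}}`, and lift the
  polynomial of `G_{n,λ^{(j)}}` that belongs to `(α₂, …, α_{n+1})`. -/
  step : ∀ n : ℕ, 1 ≤ n → ∀ lam : YoungDiagram, 1 ≤ lam.card → lam.card ≤ n + 2 →
    ∀ α ∈ codeSet (n + 1) lam, ∃ (j : ℕ) (mu : YoungDiagram),
      IsLowered lam j mu ∧ ¬ (j = 0 ∧ lam.card = n + 2) ∧
      α 0 = lam.colLen j ∧ Fin.tail α ∈ codeSet n mu ∧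
      IsLift n lam j mu (∑ i, Fin.tail α i) (G n mu (Fin.tail α)) (G (n + 1) lam α)

/-- `G_{n,λ}` as a set of polynomials with rational coefficients: the images of the integer
polynomials `G n λ α`, for `α ∈ D_{n,λ}`. -/
def groebnerSet (G : (n : ℕ) → YoungDiagram → (Fin n → ℕ) → MvPolynomial (Fin n) ℤ)
    (n : ℕ) (lam : YoungDiagram) : Set (MvPolynomial (Fin n) ℚ) :=
  (fun α => map (Int.castRingHom ℚ) (G n lam α)) '' codeSet n lam

end Griffin

namespace Griffin

open MvPolynomial

/-! ### Removing and adding the smallest number of a container diagram -/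

/-! Codes. Deleting the smallest number, with its box if it has one, preserves the rest of the code,
and the deleted entry is `λ'_{j+1}`, where the box was in row `j` (`j = 0` for a floating number).
Conversely, every code of `λ^{(j)}` extends by `λ'_{j+1}` (`exists_tail_mem_codeSet`,
`cons_mem_codeSet`).

Polynomials. Whatever coefficients are chosen, `F` is congruent to `x₁^a f̃` modulo `x₁^(a+1)`.
Since `F` is homogeneous, and among monomials of equal degree a smaller exponent of `x₁` wins, the
leading monomial of `F` is `x₁^a` times that of `f̃` (`degree_lift`). Membership in `J_{n,λ}`
reduces to `liftedGenerator_mem`, a consequence of `e_{d+1}(S ⊔ {i}) = e_{d+1}(S) + xᵢ e_d(S)`.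

Gröbner property for finite `s`. Let `Z` be the set of points of `{0, …, s-1}^n` that take each
value `k` at least `lam.rowLen k` times. Every generator of `I_{n,λ,s}` is the top form of a
polynomial vanishing on `Z`, so leading monomials of the ideal are leading monomials of polynomials
vanishing on `Z` (`exists_vanishes_degree_eq`). Monomials that are not such leading monomials span
the functions on `Z`. On the other hand, at most `|Z|` monomials are divisible by no `xᵢ^s` and no
`x^α` (`card_standardExponents_le`, by the recursion for codes). A further leading monomial of the
ideal among them would leave fewer than `|Z|` monomials to span a space of dimension `|Z|`
(`exists_le_degree`).

For `s = ∞`, each polynomial is treated with a finite `s` exceeding the degree of its leading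
monomial. -/

theorem mem_transpose_iff {lam : YoungDiagram} {b : ℕ × ℕ} :
    b ∈ lam.transpose ↔ b.2 < lam.colLen b.1 := by
  rw [YoungDiagram.mem_transpose, ← YoungDiagram.mem_iff_lt_colLen]
  rfl

theorem IsLowered.eq_of_zero {lam mu : YoungDiagram} (h : IsLowered lam 0 mu) : mu = lam := by
  ext ⟨r, c⟩
  rw [YoungDiagram.mem_cells, YoungDiagram.mem_cells, YoungDiagram.mem_iff_lt_colLen,
    YoungDiagram.mem_iff_lt_colLen, h c]
  simp

theorem isLowered_zero (lam : YoungDiagram) : IsLowered lam 0 lam := fun i => by simp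

theorem IsLowered.colLen_le {lam mu : YoungDiagram} {j : ℕ} (h : IsLowered lam j mu) (i : ℕ) :
    mu.colLen i ≤ lam.colLen i := by
  rw [h i]; exact Nat.le_add_right _ _

theorem IsLowered.mem_transpose_iff {lam mu : YoungDiagram} {r : ℕ}
    (h : IsLowered lam (r + 1) mu) {b : ℕ × ℕ} :
    b ∈ lam.transpose ↔ b ∈ mu.transpose ∨ b = (r, mu.colLen r) := by
  obtain ⟨x, y⟩ := b
  rw [Griffin.mem_transpose_iff, Griffin.mem_transpose_iff, Prod.mk.injEq]
  have := h x
  dsimp only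
  split_ifs at this with hx
  · obtain rfl : x = r := by omega
    omega
  · have : x ≠ r := by omega
    omega

/-- The strict drop makes the last box of column `r` a removable corner. -/
theorem exists_isLowered {lam : YoungDiagram} {r : ℕ} (h : lam.colLen (r + 1) < lam.colLen r) :
    ∃ mu, IsLowered lam (r + 1) mu := by
  have key : ∀ i j, (i, j) ∈ lam.cells.erase (lam.colLen r - 1, r) ↔
      i < lam.colLen j - if j + 1 = r + 1 then 1 else 0 := by
    intro i j
    rw [Finset.mem_erase, YoungDiagram.mem_cells, YoungDiagram.mem_iff_lt_colLen, Ne,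
      Prod.mk.injEq]
    split_ifs with hj
    · obtain rfl : j = r := by omega
      omega
    · have : j ≠ r := by omega
      simp [this]
  have hlow : IsLowerSet (lam.cells.erase (lam.colLen r - 1, r) : Set (ℕ × ℕ)) := by
    rintro ⟨i, j⟩ ⟨i', j'⟩ ⟨hi, hj⟩ hm
    rw [Finset.mem_coe, key] at hm ⊢
    dsimp only at hi hj
    have hle := lam.colLen_anti j' j hj
    by_cases hj' : j' = r
    · subst hj'
      rw [if_pos rfl]
      rcases hj.eq_or_lt with rfl | hlt
      · rw [if_pos rfl] at hm
        omega
      · have := lam.colLen_anti (j' + 1) j hlt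
        omega
    · rw [if_neg (by omega)]
      omega
  refine ⟨⟨lam.cells.erase (lam.colLen r - 1, r), hlow⟩, fun j => ?_⟩
  have h2 : ∀ i, i < YoungDiagram.colLen ⟨lam.cells.erase (lam.colLen r - 1, r), hlow⟩ j ↔
      i < lam.colLen j - if j + 1 = r + 1 then 1 else 0 := fun i => by
    rw [← YoungDiagram.mem_iff_lt_colLen, ← key]
    rfl
  have h3 := eq_of_forall_lt_iff h2
  rw [h3]
  split_ifs with hj
  · obtain rfl : j = r := by omega
    omega
  · omega

theorem card_transpose (lam : YoungDiagram) : lam.transpose.card = lam.card := by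
  rw [YoungDiagram.card, YoungDiagram.transpose]
  exact Finset.card_equiv (Equiv.prodComm ℕ ℕ) (by simp)

theorem IsLowered.card {lam mu : YoungDiagram} {r : ℕ} (h : IsLowered lam (r + 1) mu) :
    lam.card = mu.card + 1 := by
  rw [← card_transpose lam, ← card_transpose mu]
  have h1 : lam.transpose.cells = insert (r, mu.colLen r) mu.transpose.cells := by
    ext b
    rw [YoungDiagram.mem_cells, h.mem_transpose_iff, Finset.mem_insert, YoungDiagram.mem_cells]
    tauto
  rw [YoungDiagram.card, h1, Finset.card_insert_of_notMem]
  rw [YoungDiagram.mem_cells, Griffin.mem_transpose_iff]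
  exact lt_irrefl _

namespace ContainerDiagram

/-- `σ` arises from `σ'` by adding a new smallest number, and also the box that contains it if
this number does not float. -/
structure Extends {n : ℕ} {lam mu : YoungDiagram} (σ : ContainerDiagram (n + 1) lam)
    (σ' : ContainerDiagram n mu) : Prop where
  col_succ : ∀ i, σ.col i.succ = σ'.col i
  row_succ : ∀ i, σ.row i.succ = σ'.row i
  mem_iff : ∀ b, b ∈ lam.transpose ↔ b ∈ mu.transpose ∨ σ.InBox 0 b
  not_mem : ∀ b ∈ mu.transpose, ¬ σ.InBox 0 b

namespace Extends

variable {n : ℕ} {lam mu : YoungDiagram} {σ : ContainerDiagram (n + 1) lam}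
  {σ' : ContainerDiagram n mu}

theorem inBox_succ (h : σ.Extends σ') (i : Fin n) (b : ℕ × ℕ) :
    σ.InBox i.succ b ↔ σ'.InBox i b := by
  rw [InBox, InBox, h.col_succ, h.row_succ]

/-- A box holding the new smallest number is never larger than an old number, so it is never
counted. This is why old code entries and the third condition survive the passage between the two
diagrams. -/
theorem larger_iff (h : σ.Extends σ') (i : Fin n) (b : ℕ × ℕ) :
    (b ∈ lam.transpose ∧ σ.Larger i.succ b) ↔ (b ∈ mu.transpose ∧ σ'.Larger i b) := by
  rw [h.mem_iff]
  constructor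
  · rintro ⟨h1, h2⟩
    have h0 : ¬ σ.InBox 0 b := fun h0 => absurd (h2 0 h0) (Fin.not_lt_zero _)
    refine ⟨h1.resolve_right h0, fun k hk => ?_⟩
    exact Fin.succ_lt_succ_iff.1 (h2 k.succ ((h.inBox_succ k b).2 hk))
  · rintro ⟨h1, h2⟩
    refine ⟨Or.inl h1, fun k hk => ?_⟩
    induction k using Fin.cases with
    | zero => exact absurd hk (h.not_mem b h1)
    | succ k => exact Fin.succ_lt_succ_iff.2 (h2 k ((h.inBox_succ k b).1 hk))

theorem isEmptyBox_iff (h : σ.Extends σ') (b : ℕ × ℕ) : σ.IsEmptyBox b ↔ σ'.IsEmptyBox b := by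
  constructor
  · rintro ⟨h1, h2⟩
    exact ⟨((h.mem_iff b).1 h1).resolve_right (h2 0), fun k hk => h2 _ ((h.inBox_succ k b).2 hk)⟩
  · rintro ⟨h1, h2⟩
    refine ⟨(h.mem_iff b).2 (Or.inl h1), fun k hk => ?_⟩
    induction k using Fin.cases with
    | zero => exact absurd hk (h.not_mem b h1)
    | succ k => exact h2 k ((h.inBox_succ k b).1 hk)

theorem condition1_iff (h : σ.Extends σ') : σ.Condition1 ↔ σ'.Condition1 := by
  simp only [Condition1, h.isEmptyBox_iff]

theorem condition3 (h : σ.Extends σ') (hσ : σ.Condition3) : σ'.Condition3 := by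
  intro i hi c hc
  obtain ⟨r, hr⟩ := hσ i.succ (by rw [h.row_succ, hi]) c (by rwa [h.col_succ])
  exact ⟨r, (h.larger_iff i _).1 hr⟩

theorem condition2 (h : σ.Extends σ') (hσ : σ.Condition2) : σ'.Condition2 := by
  refine ⟨fun i k r hi hk hik => ?_, (h.isEmptyBox_iff _).1 hσ.2⟩
  rw [← h.row_succ] at hi hk
  rw [← h.col_succ, ← h.col_succ] at hik
  exact Fin.succ_lt_succ_iff.1 (hσ.1 _ _ r hi hk hik)

theorem code_succ (h : σ.Extends σ') (i : Fin n) : σ.code i.succ = σ'.code i := by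
  classical
  rw [code, code, h.row_succ]
  have key : ∀ P Q : ℕ × ℕ → Prop, (∀ b, P b ↔ Q b) →
      (lam.transpose.cells.filter fun b => P b ∧ σ.Larger i.succ b) =
        mu.transpose.cells.filter fun b => Q b ∧ σ'.Larger i b := by
    intro P Q hPQ
    ext b
    have := h.larger_iff i b
    rw [Finset.mem_filter, Finset.mem_filter, YoungDiagram.mem_cells, YoungDiagram.mem_cells,
      hPQ b]
    tauto
  cases σ'.row i with
  | none =>
    dsimp only
    rw [h.col_succ]
    congr 2
    convert key _ _ (fun b => Iff.rfl)
  | some r =>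
    dsimp only
    rw [h.col_succ]
    congr 1
    convert key _ _ (fun b => Iff.rfl)

end Extends

/-- The smallest number ends row `r`, so nothing lies to its right; all of row `r + 1` lies to its
left and beats it. -/
theorem code_of_row_eq_some {n : ℕ} {lam : YoungDiagram} (σ : ContainerDiagram (n + 1) lam)
    {r : ℕ} (hr : σ.row 0 = some r) (h1 : lam.colLen r = σ.col 0 + 1)
    (h2 : lam.colLen (r + 1) ≤ σ.col 0) : σ.code 0 = lam.colLen (r + 1) := by
  classical
  rw [code, hr]
  dsimp only
  rw [← Finset.card_range (lam.colLen (r + 1))]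
  symm
  refine Finset.card_bij (fun c _ => (r + 1, c)) ?_ (fun _ _ _ _ h => (Prod.mk.inj h).2) ?_
  · intro c hc
    rw [Finset.mem_range] at hc
    rw [Finset.mem_filter, YoungDiagram.mem_cells, mem_transpose_iff]
    refine ⟨hc, Or.inr ⟨rfl, by dsimp only; omega⟩, fun k hk => Fin.pos_of_ne_zero ?_⟩
    rintro rfl
    have := hk.1
    rw [hr] at this
    simp at this
  · rintro ⟨x, y⟩ hb
    rw [Finset.mem_filter, YoungDiagram.mem_cells, mem_transpose_iff] at hb
    dsimp only at hb
    obtain ⟨hb, hb2 | hb2, -⟩ := hb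
    · rw [hb2.1] at hb
      omega
    · exact ⟨y, by rw [Finset.mem_range, ← hb2.1]; exact hb, by rw [hb2.1]⟩

theorem code_of_row_eq_none {n : ℕ} {lam : YoungDiagram} (σ : ContainerDiagram (n + 1) lam)
    (hr : σ.row 0 = none) (h : σ.col 0 = lam.colLen 0) : σ.code 0 = lam.colLen 0 := by
  classical
  rw [code, hr]
  dsimp only
  rw [Finset.card_eq_zero.2, h, add_zero]
  rw [Finset.filter_eq_empty_iff]
  rintro ⟨x, y⟩ hb ⟨⟨h1, h2⟩, -⟩
  rw [YoungDiagram.mem_cells, mem_transpose_iff] at hb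
  dsimp only at *
  subst h1
  omega

end ContainerDiagram

/-! ### The recursion for codes -/

open ContainerDiagram

/-- Number `1` is removed from a diagram. -/
theorem exists_tail_mem_codeSet {n : ℕ} {lam : YoungDiagram} {α : Fin (n + 1) → ℕ}
    (hα : α ∈ codeSet (n + 1) lam) :
    ∃ j mu, IsLowered lam j mu ∧ α 0 = lam.colLen j ∧ Fin.tail α ∈ codeSet n mu := by
  obtain ⟨σ, c1, c2, c3, rfl⟩ := hα
  suffices H : ∃ j mu, IsLowered lam j mu ∧ σ.code 0 = lam.colLen j ∧
      ∃ σ' : ContainerDiagram n mu, σ.Extends σ' by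
    obtain ⟨j, mu, h1, h2, σ', h⟩ := H
    exact ⟨j, mu, h1, h2, σ', h.condition1_iff.1 c1, h.condition2 c2, h.condition3 c3,
      funext fun i => (h.code_succ i).symm⟩
  -- The corner is the unique empty box, so every other box holds a number.
  have hfull : ∀ b ∈ lam.transpose, b ≠ (0, 0) → ∃ k, σ.InBox k b := by
    intro b hb hb0
    by_contra! hc
    exact hb0 (c1.unique ⟨hb, hc⟩ c2.2)
  cases hr : σ.row 0 with
  | none =>
    -- Above a box, the smallest number would float over a smaller number or over an empty box.
    -- Further right, the third condition would require a box in column `lam.colLen 0`, which has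
    -- none.
    have hcol : σ.col 0 = lam.colLen 0 := by
      rcases lt_trichotomy (σ.col 0) (lam.colLen 0) with h | h | h
      · have hb : (0, σ.col 0) ∈ lam.transpose := mem_transpose_iff.2 h
        by_cases he : ∃ k, σ.InBox k (0, σ.col 0)
        · obtain ⟨k, hk⟩ := he
          exact absurd (σ.float_decreasing 0 k 0 hr hk.1 hk.2.symm) (Fin.not_lt_zero _)
        · obtain ⟨r, h1, -⟩ := σ.below_empty _ _ hb (fun k hk => he ⟨k, hk⟩) 0 rfl
          rw [hr] at h1
          cases h1
      · exact h
      · obtain ⟨r, h1, -⟩ := c3 0 hr _ h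
        rw [mem_transpose_iff] at h1
        exact absurd (lam.colLen_anti 0 r (Nat.zero_le _)) (not_le.2 h1)
    have h0 : ∀ b, ¬ σ.InBox 0 b := fun b hb => by rw [InBox, hr] at hb; cases hb.1
    refine ⟨0, lam, isLowered_zero lam, σ.code_of_row_eq_none hr hcol,
      ⟨fun i => σ.col i.succ, fun i => σ.row i.succ, fun i => σ.mem_box i.succ, ?_, ?_, ?_, ?_⟩,
      ⟨fun _ => rfl, fun _ => rfl, fun b => ⟨Or.inl, fun h => h.resolve_right (h0 b)⟩,
        fun b _ => h0 b⟩⟩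
    · exact fun i k r h1 h2 h3 => Fin.succ_injective _ (σ.box_unique _ _ r h1 h2 h3)
    · intro r c hb he i hi
      refine σ.below_empty r c hb (fun k => ?_) i.succ hi
      induction k using Fin.cases with
      | zero => exact h0 (r, c)
      | succ k => exact he k
    · exact fun i k r r' h1 h2 h3 h4 =>
        Fin.succ_lt_succ_iff.1 (σ.box_decreasing _ _ r r' h1 h2 h3 h4)
    · exact fun i k r h1 h2 h3 => Fin.succ_lt_succ_iff.1 (σ.float_decreasing _ _ r h1 h2 h3)
  | some r =>
    have hb := σ.mem_box 0 r hr
    rw [mem_transpose_iff] at hb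
    dsimp only at hb
    -- A box to the right in the same row would have to hold a smaller number; likewise, below, for
    -- a box underneath.
    have h1 : lam.colLen r = σ.col 0 + 1 := by
      by_contra hne
      obtain ⟨k, hk1, hk2⟩ := hfull (r, σ.col 0 + 1)
        (mem_transpose_iff.2 (by dsimp only; omega)) (by simp)
      dsimp only at hk2
      exact absurd (c2.1 0 k r hr hk1 (by omega)) (Fin.not_lt_zero _)
    have h2 : lam.colLen (r + 1) ≤ σ.col 0 := by
      by_contra! hlt
      obtain ⟨k, hk1, hk2⟩ := hfull (r + 1, σ.col 0) (mem_transpose_iff.2 hlt) (by simp)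
      exact absurd (σ.box_decreasing 0 k r (r + 1) hr hk1 hk2.symm (by omega))
        (Fin.not_lt_zero _)
    obtain ⟨mu, hmu⟩ := exists_isLowered (lam := lam) (r := r) (by omega)
    have hc : mu.colLen r = σ.col 0 := by
      have := hmu r
      rw [if_pos rfl] at this
      omega
    have hin : ∀ b, σ.InBox 0 b ↔ b = (r, mu.colLen r) := by
      rintro ⟨x, y⟩
      rw [InBox, hr, hc, Option.some_inj, Prod.mk.injEq]
      dsimp only
      constructor <;> exact fun h => ⟨h.1.symm, h.2.symm⟩
    have hmem : ∀ b, b ∈ lam.transpose ↔ b ∈ mu.transpose ∨ σ.InBox 0 b := fun b => by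
      rw [hmu.mem_transpose_iff, hin]
    have hnot : ∀ b ∈ mu.transpose, ¬ σ.InBox 0 b := by
      intro b hb h
      rw [hin] at h
      rw [h, mem_transpose_iff] at hb
      exact lt_irrefl _ hb
    refine ⟨r + 1, mu, hmu, σ.code_of_row_eq_some hr h1 h2,
      ⟨fun i => σ.col i.succ, fun i => σ.row i.succ, ?_, ?_, ?_, ?_, ?_⟩,
      ⟨fun _ => rfl, fun _ => rfl, hmem, hnot⟩⟩
    · intro i x hx
      refine ((hmem _).1 (σ.mem_box i.succ x hx)).resolve_right fun h => ?_
      exact Fin.succ_ne_zero i (σ.box_unique _ _ x hx h.1 h.2.symm)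
    · exact fun i k r h1 h2 h3 => Fin.succ_injective _ (σ.box_unique _ _ r h1 h2 h3)
    · intro r c hb he i hi
      refine σ.below_empty r c ((hmem _).2 (Or.inl hb)) (fun k => ?_) i.succ hi
      induction k using Fin.cases with
      | zero => exact hnot _ hb
      | succ k => exact he k
    · exact fun i k r r' h1 h2 h3 h4 =>
        Fin.succ_lt_succ_iff.1 (σ.box_decreasing _ _ r r' h1 h2 h3 h4)
    · exact fun i k r h1 h2 h3 => Fin.succ_lt_succ_iff.1 (σ.float_decreasing _ _ r h1 h2 h3)

/-- Number `1` is added to a diagram. -/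
theorem cons_mem_codeSet {n : ℕ} {lam mu : YoungDiagram} {j : ℕ} (hmu : IsLowered lam j mu)
    {β : Fin n → ℕ} (hβ : β ∈ codeSet n mu) :
    (Fin.cons (lam.colLen j) β : Fin (n + 1) → ℕ) ∈ codeSet (n + 1) lam := by
  obtain ⟨σ', c1, c2, c3, rfl⟩ := hβ
  -- The last two clauses are what the new number must satisfy for row decrease and for the third
  -- condition; in the latter, the top box of every column to its left is the required box.
  suffices H : ∃ σ : ContainerDiagram (n + 1) lam, σ.Extends σ' ∧ σ.code 0 = lam.colLen j ∧
      (∀ k r, σ.row 0 = some r → σ.row k = some r → ¬ σ.col 0 < σ.col k) ∧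
      (σ.row 0 = none → σ.col 0 ≤ lam.colLen 0) by
    obtain ⟨σ, h, h1, h2, h3⟩ := H
    refine ⟨σ, h.condition1_iff.2 c1, ⟨?_, (h.isEmptyBox_iff _).2 c2.2⟩, ?_, ?_⟩
    · intro i k r hi hk hik
      induction i using Fin.cases with
      | zero => exact absurd hik (h2 k r hi hk)
      | succ i =>
        induction k using Fin.cases with
        | zero => exact Fin.succ_pos i
        | succ k =>
          rw [h.row_succ] at hi hk
          rw [h.col_succ, h.col_succ] at hik
          exact Fin.succ_lt_succ_iff.2 (c2.1 i k r hi hk hik)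
    · intro i hi c hc
      induction i using Fin.cases with
      | zero =>
        refine ⟨0, mem_transpose_iff.2 (hc.trans_le (h3 hi)), fun k hk => Fin.pos_of_ne_zero ?_⟩
        rintro rfl
        rw [InBox, hi] at hk
        cases hk.1
      | succ i =>
        rw [h.row_succ] at hi
        rw [h.col_succ] at hc
        obtain ⟨r, hr⟩ := c3 i hi c hc
        exact ⟨r, (h.larger_iff i _).2 hr⟩
    · funext i
      induction i using Fin.cases with
      | zero => rw [h1, Fin.cons_zero]
      | succ i => rw [h.code_succ, Fin.cons_succ]
  -- For `j = 0` the new number floats over the first column without boxes; for `j + 1` it fills the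
  -- box added at the end of row `j`.
  cases j with
  | zero =>
    obtain rfl := hmu.eq_of_zero
    have hlt : ∀ i r, σ'.row i = some r → σ'.col i < mu.colLen 0 := fun i r hi =>
      lt_of_lt_of_le (mem_transpose_iff.1 (σ'.mem_box i r hi)) (mu.colLen_anti 0 r (Nat.zero_le _))
    let σ : ContainerDiagram (n + 1) mu :=
      { col := Fin.cons (mu.colLen 0) σ'.col
        row := Fin.cons none σ'.row
        mem_box := by
          intro i
          induction i using Fin.cases with
          | zero => rintro r ⟨⟩
          | succ i => exact σ'.mem_box i
        box_unique := by
          intro i k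
          induction i using Fin.cases with
          | zero => rintro r ⟨⟩
          | succ i =>
            induction k using Fin.cases with
            | zero => rintro r - ⟨⟩
            | succ k => exact fun r h1 h2 h3 => congrArg _ (σ'.box_unique i k r h1 h2 h3)
        below_empty := by
          intro r c hb he i
          induction i using Fin.cases with
          | zero =>
            rintro rfl
            rw [mem_transpose_iff] at hb
            exact absurd (mu.colLen_anti 0 r (Nat.zero_le _)) (not_le.2 hb)
          | succ i => exact σ'.below_empty r c hb (fun k => he k.succ) i
        box_decreasing := by
          intro i k
          induction i using Fin.cases with
          | zero => rintro r r' ⟨⟩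
          | succ i =>
            induction k using Fin.cases with
            | zero => rintro r r' - ⟨⟩
            | succ k =>
              exact fun r r' h1 h2 h3 h4 =>
                Fin.succ_lt_succ_iff.2 (σ'.box_decreasing i k r r' h1 h2 h3 h4)
        float_decreasing := by
          intro i k
          induction k using Fin.cases with
          | zero => rintro r - ⟨⟩
          | succ k =>
            induction i using Fin.cases with
            | zero => exact fun r _ h2 h3 => absurd h3 (hlt k r h2).ne'
            | succ i =>
              exact fun r h1 h2 h3 => Fin.succ_lt_succ_iff.2 (σ'.float_decreasing i k r h1 h2 h3) }
    have h0 : ∀ b, ¬ σ.InBox 0 b := fun b hb => by cases hb.1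
    refine ⟨σ, ⟨fun _ => rfl, fun _ => rfl, fun b => ⟨Or.inl, fun h => h.resolve_right (h0 b)⟩,
      fun b _ => h0 b⟩, σ.code_of_row_eq_none rfl rfl, ?_, fun _ => le_rfl⟩
    rintro k r ⟨⟩
  | succ j =>
    have hj := hmu j
    rw [if_pos rfl] at hj
    have hj1 := hmu (j + 1)
    rw [if_neg (by omega), add_zero] at hj1
    have hanti : mu.colLen (j + 1) ≤ mu.colLen j := mu.colLen_anti _ _ (by omega)
    have hlt : ∀ i r, σ'.row i = some r → j ≤ r → σ'.col i < mu.colLen j := fun i r hi hr =>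
      lt_of_lt_of_le (mem_transpose_iff.1 (σ'.mem_box i r hi)) (mu.colLen_anti j r hr)
    let σ : ContainerDiagram (n + 1) lam :=
      { col := Fin.cons (mu.colLen j) σ'.col
        row := Fin.cons (some j) σ'.row
        mem_box := by
          intro i
          induction i using Fin.cases with
          | zero =>
            rintro r ⟨⟩
            exact mem_transpose_iff.2 (by rw [Fin.cons_zero]; dsimp only; omega)
          | succ i => exact fun r hr => hmu.mem_transpose_iff.2 (Or.inl (σ'.mem_box i r hr))
        box_unique := by
          intro i k
          induction i using Fin.cases with
          | zero =>
            induction k using Fin.cases with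
            | zero => exact fun _ _ _ _ => rfl
            | succ k =>
              rintro r ⟨⟩ h2 h3
              exact absurd h3.symm (hlt k j h2 le_rfl).ne
          | succ i =>
            induction k using Fin.cases with
            | zero =>
              rintro r h2 ⟨⟩ h3
              exact absurd h3 (hlt i j h2 le_rfl).ne
            | succ k => exact fun r h1 h2 h3 => congrArg _ (σ'.box_unique i k r h1 h2 h3)
        below_empty := by
          intro r c hb he i
          have hne : ¬ (r, c) = (j, mu.colLen j) := by
            rintro ⟨⟩
            exact he 0 ⟨rfl, rfl⟩
          have hb' := (hmu.mem_transpose_iff.1 hb).resolve_right hne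
          induction i using Fin.cases with
          | zero =>
            rintro rfl
            refine ⟨j, rfl, ?_⟩
            by_contra! hle
            exact absurd (mu.colLen_anti j r hle) (not_le.2 (mem_transpose_iff.1 hb'))
          | succ i => exact σ'.below_empty r c hb' (fun k => he k.succ) i
        box_decreasing := by
          intro i k
          induction i using Fin.cases with
          | zero =>
            induction k using Fin.cases with
            | zero =>
              rintro r r' ⟨⟩ ⟨⟩ - h
              exact absurd h (lt_irrefl _)
            | succ k =>
              rintro r r' ⟨⟩ h2 h3 h4
              exact absurd h3.symm (hlt k r' h2 h4.le).ne
          | succ i =>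
            induction k using Fin.cases with
            | zero => exact fun _ _ _ _ _ _ => Fin.succ_pos i
            | succ k =>
              exact fun r r' h1 h2 h3 h4 =>
                Fin.succ_lt_succ_iff.2 (σ'.box_decreasing i k r r' h1 h2 h3 h4)
        float_decreasing := by
          intro i k
          induction i using Fin.cases with
          | zero => rintro r ⟨⟩
          | succ i =>
            induction k using Fin.cases with
            | zero => exact fun _ _ _ _ => Fin.succ_pos i
            | succ k =>
              exact fun r h1 h2 h3 => Fin.succ_lt_succ_iff.2 (σ'.float_decreasing i k r h1 h2 h3) }
    have hin : ∀ b, σ.InBox 0 b ↔ b = (j, mu.colLen j) := by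
      rintro ⟨x, y⟩
      rw [Prod.mk.injEq]
      constructor
      · rintro ⟨⟨⟩, h⟩
        exact ⟨rfl, h.symm⟩
      · rintro ⟨rfl, rfl⟩
        exact ⟨rfl, rfl⟩
    refine ⟨σ, ⟨fun _ => rfl, fun _ => rfl, fun b => by rw [hmu.mem_transpose_iff, hin], ?_⟩,
      σ.code_of_row_eq_some rfl hj (hj1 ▸ hanti), ?_, ?_⟩
    · intro b hb h
      rw [hin] at h
      rw [h, mem_transpose_iff] at hb
      exact lt_irrefl _ hb
    · intro k
      induction k using Fin.cases with
      | zero => exact fun _ _ _ => lt_irrefl _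
      | succ k =>
        rintro r ⟨⟩ h2
        exact (hlt k j h2 le_rfl).not_gt
    · rintro ⟨⟩

/-! ### Size constraints, finiteness, and the zero code -/

theorem card_pos_of_mem_codeSet {n : ℕ} {lam : YoungDiagram} {α : Fin n → ℕ}
    (hα : α ∈ codeSet n lam) : 1 ≤ lam.card := by
  obtain ⟨σ, -, c2, -, -⟩ := hα
  rw [← card_transpose]
  exact Finset.card_pos.2 ⟨_, (YoungDiagram.mem_cells _).2 c2.2.1⟩

/-- All boxes but the single empty one are occupied by distinct numbers. -/
theorem card_le_of_mem_codeSet {n : ℕ} {lam : YoungDiagram} {α : Fin n → ℕ}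
    (hα : α ∈ codeSet n lam) : lam.card ≤ n + 1 := by
  obtain ⟨σ, ⟨b₀, -, hb⟩, -, -, -⟩ := hα
  have hsub : lam.transpose.cells ⊆
      insert b₀ (Finset.univ.image fun k => ((σ.row k).getD 0, σ.col k)) := by
    intro b hmem
    rw [Finset.mem_insert]
    by_cases h : ∃ k, σ.InBox k b
    · obtain ⟨k, h1, h2⟩ := h
      exact Or.inr (Finset.mem_image.2 ⟨k, Finset.mem_univ _, by rw [h1, h2]; rfl⟩)
    · exact Or.inl (hb b ⟨hmem, fun k hk => h ⟨k, hk⟩⟩)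
  rw [← card_transpose]
  refine (Finset.card_le_card hsub).trans ((Finset.card_insert_le _ _).trans ?_)
  have := Finset.card_image_le (s := (Finset.univ : Finset (Fin n)))
    (f := fun k => ((σ.row k).getD 0, σ.col k))
  rw [Finset.card_univ, Fintype.card_fin] at this
  omega

theorem le_colLen_of_mem_codeSet {n : ℕ} {lam : YoungDiagram} {α : Fin n → ℕ}
    (hα : α ∈ codeSet n lam) (i : Fin n) : α i ≤ lam.colLen 0 := by
  induction n generalizing lam with
  | zero => exact i.elim0
  | succ n ih =>
    obtain ⟨j, mu, hmu, h0, ht⟩ := exists_tail_mem_codeSet hα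
    induction i using Fin.cases with
    | zero => exact h0 ▸ lam.colLen_anti 0 j (Nat.zero_le _)
    | succ i => exact (ih ht i).trans (hmu.colLen_le 0)

theorem finite_codeSet (n : ℕ) (lam : YoungDiagram) : (codeSet n lam).Finite :=
  (Set.finite_Iic fun _ : Fin n => lam.colLen 0).subset fun _ hα i =>
    le_colLen_of_mem_codeSet hα i

theorem mem_of_card_pos {lam : YoungDiagram} (h : 1 ≤ lam.card) : (0, 0) ∈ lam := by
  obtain ⟨b, hb⟩ := Finset.card_pos.1 h
  exact lam.up_left_mem (Nat.zero_le _) (Nat.zero_le _) ((YoungDiagram.mem_cells _).1 hb)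

/-- The last column of a nonempty diagram can be lowered. -/
theorem exists_isLowered_colLen_eq_zero {lam : YoungDiagram} (h : 1 ≤ lam.card) :
    ∃ r mu, IsLowered lam (r + 1) mu ∧ lam.colLen (r + 1) = 0 := by
  have h0 : 0 < lam.rowLen 0 := YoungDiagram.mem_iff_lt_rowLen.1 (mem_of_card_pos h)
  have h1 : lam.colLen (lam.rowLen 0 - 1 + 1) = 0 := by
    by_contra hne
    have := YoungDiagram.mem_iff_lt_colLen.2 (Nat.pos_of_ne_zero hne)
    rw [YoungDiagram.mem_iff_lt_rowLen] at this
    omega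
  have h2 : 0 < lam.colLen (lam.rowLen 0 - 1) := by
    rw [← YoungDiagram.mem_iff_lt_colLen, YoungDiagram.mem_iff_lt_rowLen]
    omega
  obtain ⟨mu, hmu⟩ := exists_isLowered (lam := lam) (r := lam.rowLen 0 - 1) (by omega)
  exact ⟨_, mu, hmu, h1⟩

/-- Repeatedly lowering the last nonempty column contributes the entry `lam.colLen (r + 1) = 0` each
time, until one empty box is left. Hence the case of maximal size has no standard monomials. -/
theorem zero_mem_codeSet {n : ℕ} {lam : YoungDiagram} (h : lam.card = n + 1) :
    (0 : Fin n → ℕ) ∈ codeSet n lam := by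
  induction n generalizing lam with
  | zero =>
    have hmem : ∀ b, b ∈ lam.transpose ↔ b = (0, 0) := by
      rw [zero_add, ← card_transpose, YoungDiagram.card, Finset.card_eq_one] at h
      obtain ⟨b, hb⟩ := h
      have h0 := mem_of_card_pos (lam := lam.transpose)
        (by rw [YoungDiagram.card, hb, Finset.card_singleton])
      rw [← YoungDiagram.mem_cells, hb, Finset.mem_singleton] at h0
      intro b'
      rw [← YoungDiagram.mem_cells, hb, Finset.mem_singleton, h0]
    have he : ∀ b, b ∈ lam.transpose → ∀ k : Fin 0, ¬ (none = some b.1 ∧ 0 = b.2) :=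
      fun _ _ k => k.elim0
    let σ : ContainerDiagram 0 lam :=
      { col := fun _ => 0
        row := fun _ => none
        mem_box := fun i => i.elim0
        box_unique := fun i => i.elim0
        below_empty := fun _ _ _ _ i => i.elim0
        box_decreasing := fun i => i.elim0
        float_decreasing := fun i => i.elim0 }
    have hE : ∀ b, σ.IsEmptyBox b ↔ b = (0, 0) := fun b =>
      ⟨fun h => (hmem b).1 h.1, fun h => ⟨(hmem b).2 h, fun k => k.elim0⟩⟩
    exact ⟨σ, ⟨(0, 0), (hE _).2 rfl, fun b hb => (hE b).1 hb⟩, ⟨fun i => i.elim0, (hE _).2 rfl⟩,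
      fun i => i.elim0, funext fun i => i.elim0⟩
  | succ n ih =>
    obtain ⟨r, mu, hmu, h0⟩ := exists_isLowered_colLen_eq_zero (lam := lam) (by omega)
    have hc := hmu.card
    have h1 := cons_mem_codeSet hmu (ih (lam := mu) (by omega))
    rw [h0] at h1
    convert h1
    funext i
    induction i using Fin.cases with
    | zero => rfl
    | succ i => rfl

/-! ### Elementary symmetric polynomials and the ideals -/

section ElementarySymmetric

variable {R : Type*} [CommRing R] {n : ℕ}

theorem e_zero (S : Finset (Fin n)) : e R 0 S = 1 := by
  simp [e]

theorem e_insert_succ {i : Fin n} {S : Finset (Fin n)} (hi : i ∉ S) (d : ℕ) :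
    e R (d + 1) (insert i S) = e R (d + 1) S + X i * e R d S := by
  have hS : ∀ t ∈ S.powersetCard d, i ∉ t := fun t ht h =>
    hi ((Finset.mem_powersetCard.1 ht).1 h)
  rw [e, Finset.powersetCard_succ_insert hi, Finset.sum_union, Finset.sum_image, e, e,
    Finset.mul_sum]
  · congr 1
    exact Finset.sum_congr rfl fun t ht => Finset.prod_insert (hS t ht)
  · intro t ht t' ht' h
    rw [← Finset.erase_insert (hS t ht), ← Finset.erase_insert (hS t' ht'), h]
  · rw [Finset.disjoint_left]
    intro t ht ht'
    obtain ⟨u, -, rfl⟩ := Finset.mem_image.1 ht'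
    exact hi ((Finset.mem_powersetCard.1 ht).1 (Finset.mem_insert_self _ _))

theorem rename_succ_e (d : ℕ) (S : Finset (Fin n)) :
    rename Fin.succ (e R d S) = e R d (S.map (Fin.succEmb n)) := by
  rw [e, e, Finset.powersetCard_map, Finset.sum_map, map_sum]
  refine Finset.sum_congr rfl fun t _ => ?_
  rw [map_prod]
  simp [Finset.mapEmbedding_apply]

theorem isHomogeneous_e (d : ℕ) (S : Finset (Fin n)) : (e R d S).IsHomogeneous d := by
  refine IsHomogeneous.sum _ _ _ fun t ht => ?_
  have := IsHomogeneous.prod t (fun i => (X i : MvPolynomial (Fin n) R)) (fun _ => 1)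
    fun i _ => isHomogeneous_X R i
  rwa [Finset.sum_const, (Finset.mem_powersetCard.1 ht).2, smul_eq_mul, mul_one] at this

theorem zero_notMem_map_succEmb (S : Finset (Fin n)) : (0 : Fin (n + 1)) ∉ S.map (Fin.succEmb n) := by
  simp

theorem map_e {R' : Type*} [CommRing R'] (φ : R →+* R') (d : ℕ) (S : Finset (Fin n)) :
    map φ (e R d S) = e R' d S := by
  simp [e]

end ElementarySymmetric

/-! ### Recursions for `pSum` and membership of the lifted generators -/

theorem colLen_eq_zero {lam : YoungDiagram} {i : ℕ} (h : lam.rowLen 0 ≤ i) : lam.colLen i = 0 := by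
  by_contra hne
  have := YoungDiagram.mem_iff_lt_colLen.2 (Nat.pos_of_ne_zero hne)
  rw [YoungDiagram.mem_iff_lt_rowLen] at this
  omega

theorem pSum_eq {n m N : ℕ} {lam : YoungDiagram} (h : lam.rowLen 0 ≤ N) :
    pSum n m lam = ∑ i ∈ Finset.Ico (n - m) N, lam.colLen i := by
  refine Finset.sum_subset (Finset.Ico_subset_Ico_right h) fun i hi hi' => colLen_eq_zero ?_
  rw [Finset.mem_Ico] at hi hi'
  omega

/-- Both sums start at index `n - m`; the lowered entry has index `j - 1` and is counted exactly
when `n - m < j`. -/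
theorem pSum_succ_succ {n m j : ℕ} {lam mu : YoungDiagram} (h : IsLowered lam j mu) :
    pSum (n + 1) (m + 1) lam = pSum n m mu + if n - m < j then 1 else 0 := by
  have e1 : lam.rowLen 0 ≤ lam.rowLen 0 + mu.rowLen 0 + j := by omega
  have e2 : mu.rowLen 0 ≤ lam.rowLen 0 + mu.rowLen 0 + j := by omega
  rw [pSum_eq e1, pSum_eq e2, Finset.sum_congr rfl fun i _ => h i, Finset.sum_add_distrib,
    Nat.add_sub_add_right]
  congr 1
  split_ifs with hj
  · rw [Finset.sum_eq_single (j - 1)]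
    · rw [if_pos (by omega)]
    · intro b _ hb
      rw [if_neg (by omega)]
    · intro hb
      rw [Finset.mem_Ico] at hb
      omega
  · refine Finset.sum_eq_zero fun i hi => ?_
    rw [Finset.mem_Ico] at hi
    rw [if_neg (by omega)]

theorem pSum_succ_right {n m : ℕ} (lam : YoungDiagram) (h : m ≤ n) :
    pSum (n + 1) (m + 1) lam = lam.colLen (n - m) + pSum (n + 1) m lam := by
  have e1 : lam.rowLen 0 ≤ lam.rowLen 0 + (n + 1) := by omega
  rw [pSum_eq e1, pSum_eq e1, Nat.add_sub_add_right, Finset.sum_eq_sum_Ico_succ_bot (by omega),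
    show n - m + 1 = n + 1 - m by omega]

theorem e_mem_griffinIdeal {R : Type*} [CommRing R] {n d : ℕ} {lam : YoungDiagram}
    {S : Finset (Fin n)} (h : IsGeneratorIndex n lam d S) (s : ℕ∞) :
    e R d S ∈ griffinIdeal R n lam s :=
  Ideal.subset_span (Or.inl ⟨d, S, h, rfl⟩)

/-- Modulo `I`, multiplying `e_d(S)` by `xᵢ` gives `-e_{d+1}(S)`, so `b` factors raise the degree to
`d + b`. -/
theorem X_pow_mul_e_mem {R : Type*} [CommRing R] {n : ℕ} {I : Ideal (MvPolynomial (Fin n) R)}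
    {i : Fin n} {S : Finset (Fin n)} (hi : i ∉ S) (b d : ℕ)
    (h1 : ∀ d', d < d' → e R d' (insert i S) ∈ I) (h2 : e R (d + b) S ∈ I) :
    X i ^ b * e R d S ∈ I := by
  induction b generalizing d with
  | zero => simpa using h2
  | succ b ih =>
    have h3 : X i ^ (b + 1) * e R d S =
        X i ^ b * e R (d + 1) (insert i S) - X i ^ b * e R (d + 1) S := by
      rw [e_insert_succ hi]
      ring
    rw [h3]
    refine I.sub_mem (I.mul_mem_left _ (h1 _ (by omega))) (ih _ (fun d' hd' => h1 d' (by omega)) ?_)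
    rwa [add_right_comm]

/-- If `|S| ≥ n + 1 - j`, the bound `p` grows by one together with the set, so `e_d(S ⊔ {1})` is a
generator. Otherwise only `e_{d'}(S ⊔ {1})` with `d' > d` are guaranteed to be, and `x₁^a` raises
`e_d(S)` to a generator: omitting `1` costs `lam.colLen (n - |S|)`, which is at most `a = lam.colLen
j` because `j ≤ n - |S|`. -/
theorem liftedGenerator_mem {n j d : ℕ} {lam mu : YoungDiagram} (h : IsLowered lam j mu)
    {S : Finset (Fin n)} (hS : IsGeneratorIndex n mu d S) :
    liftedGenerator n lam j d S ∈ griffinIdeal ℤ (n + 1) lam ⊤ := by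
  have hcard : S.card ≤ n := by simpa using S.card_le_univ
  have h1 : (insert 0 (S.map (Fin.succEmb n))).card = S.card + 1 := by
    rw [Finset.card_insert_of_notMem (zero_notMem_map_succEmb S), Finset.card_map]
  have hp := pSum_succ_succ (n := n) (m := S.card) h
  rw [IsGeneratorIndex] at hS
  rw [liftedGenerator]
  split_ifs with hj
  · refine Ideal.mul_mem_left _ _ (e_mem_griffinIdeal ?_ _)
    rw [IsGeneratorIndex, h1, hp, if_pos (by omega)]
    push_cast
    omega
  · rw [if_neg (by omega)] at hp
    have hp2 := pSum_succ_right lam hcard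
    have hle : lam.colLen (n - S.card) ≤ lam.colLen j := lam.colLen_anti _ _ (by omega)
    refine X_pow_mul_e_mem (zero_notMem_map_succEmb S) _ _
      (fun d' hd' => e_mem_griffinIdeal ?_ _) (e_mem_griffinIdeal ?_ _)
    · rw [IsGeneratorIndex, h1, hp]
      push_cast
      omega
    · rw [IsGeneratorIndex, Finset.card_map]
      push_cast
      omega

theorem exists_liftedGenerator_eq (n : ℕ) (lam : YoungDiagram) (j d : ℕ) (S : Finset (Fin n)) :
    ∃ h, liftedGenerator n lam j d S =
      X 0 ^ lam.colLen j * (rename Fin.succ (e ℤ d S) + X 0 * h) := by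
  rw [liftedGenerator, rename_succ_e]
  split_ifs
  · cases d with
    | zero => exact ⟨0, by rw [e_zero, e_zero, mul_zero, add_zero]⟩
    | succ d => exact ⟨_, by rw [e_insert_succ (zero_notMem_map_succEmb S)]⟩
  · exact ⟨0, by rw [mul_zero, add_zero]⟩

theorem isHomogeneous_liftedGenerator (n : ℕ) (lam : YoungDiagram) (j d : ℕ)
    (S : Finset (Fin n)) : (liftedGenerator n lam j d S).IsHomogeneous (lam.colLen j + d) := by
  rw [liftedGenerator]
  refine (isHomogeneous_X_pow 0 _).mul ?_
  split_ifs
  · exact isHomogeneous_e _ _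
  · exact isHomogeneous_e _ _

/-! ### The lifting step -/

section Lift

variable {n j D : ℕ} {lam mu : YoungDiagram} {f : MvPolynomial (Fin n) ℤ}
  {F : MvPolynomial (Fin (n + 1)) ℤ}

theorem IsLift.mem (h : IsLowered lam j mu) (hF : IsLift n lam j mu D f F) :
    F ∈ griffinIdeal ℤ (n + 1) lam ⊤ := by
  obtain ⟨T, g, hT, -, rfl⟩ := hF
  exact Ideal.sum_mem _ fun t ht => Ideal.mul_mem_left _ _ (liftedGenerator_mem h (hT t ht).1)

theorem IsLift.isHomogeneous (hF : IsLift n lam j mu D f F) :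
    F.IsHomogeneous (lam.colLen j + D) := by
  obtain ⟨T, g, hT, -, rfl⟩ := hF
  refine IsHomogeneous.sum _ _ _ fun t ht => ?_
  obtain ⟨-, k, hk, hg⟩ := hT t ht
  have := hg.rename_isHomogeneous (f := Fin.succ) |>.mul
    (isHomogeneous_liftedGenerator n lam j t.1 t.2)
  rwa [show k + (lam.colLen j + t.1) = lam.colLen j + D by omega] at this

/-- Each lifted generator is `x₁^a e_d(S)` modulo `x₁^(a+1)`, so the part of `F` that decides the
leading term does not depend on the chosen coefficients. -/
theorem IsLift.exists_eq (hF : IsLift n lam j mu D f F) :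
    ∃ h, F = X 0 ^ lam.colLen j * (rename Fin.succ f + X 0 * h) := by
  obtain ⟨T, g, -, rfl, rfl⟩ := hF
  choose h hh using fun t : ℕ × Finset (Fin n) => exists_liftedGenerator_eq n lam j t.1 t.2
  refine ⟨∑ t ∈ T, rename Fin.succ (g t) * h t, ?_⟩
  rw [map_sum, Finset.mul_sum, ← Finset.sum_add_distrib, Finset.mul_sum]
  refine Finset.sum_congr rfl fun t _ => ?_
  rw [hh, map_mul]
  ring

end Lift

/-! ### Homogeneous representations and existence of lifts -/

theorem homogeneousComponent_mul_of_isHomogeneous {σ R : Type*} [CommRing R]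
    {f g : MvPolynomial σ R} {d : ℕ} (hg : g.IsHomogeneous d) (D : ℕ) :
    homogeneousComponent D (f * g) = if d ≤ D then homogeneousComponent (D - d) f * g else 0 := by
  conv_lhs => rw [← sum_homogeneousComponent f, Finset.sum_mul, map_sum]
  have h1 : ∀ i, homogeneousComponent D (homogeneousComponent i f * g) =
      if D = i + d then homogeneousComponent i f * g else 0 := fun i =>
    homogeneousComponent_of_mem ((homogeneousComponent_isHomogeneous i f).mul hg)
  simp_rw [h1]
  split_ifs with hd
  · rw [Finset.sum_eq_single (D - d)]
    · rw [if_pos (by omega)]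
    · intro b _ hb
      rw [if_neg (by omega)]
    · intro hb
      rw [Finset.mem_range] at hb
      rw [homogeneousComponent_eq_zero _ _ (by omega), zero_mul, ite_self]
  · exact Finset.sum_eq_zero fun i _ => if_neg (by omega)

/-- The homogeneous components of the elements of an ideal with homogeneous generators. -/
theorem exists_homogeneousComponent_eq_sum {ι σ R : Type*} [CommRing R]
    {P : Set ι} {B : ι → MvPolynomial σ R} {d : ι → ℕ} (hB : ∀ i ∈ P, (B i).IsHomogeneous (d i))
    {f : MvPolynomial σ R} (hf : f ∈ Ideal.span (B '' P)) (D : ℕ) :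
    ∃ (T : Finset ι) (g : ι → MvPolynomial σ R),
      (∀ t ∈ T, t ∈ P ∧ ∃ k, k + d t = D ∧ (g t).IsHomogeneous k) ∧
      homogeneousComponent D f = ∑ t ∈ T, g t * B t := by
  rw [Ideal.span, Finsupp.mem_span_image_iff_linearCombination] at hf
  obtain ⟨l, hl, rfl⟩ := hf
  have hlP : ∀ t ∈ l.support, t ∈ P := fun t ht => (Finsupp.mem_supported R l).1 hl ht
  refine ⟨l.support.filter fun t => d t ≤ D, fun t => homogeneousComponent (D - d t) (l t),
    fun t ht => ?_, ?_⟩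
  · rw [Finset.mem_filter] at ht
    exact ⟨hlP t ht.1, D - d t, by omega, homogeneousComponent_isHomogeneous _ _⟩
  · rw [Finsupp.linearCombination_apply, Finsupp.sum, map_sum, Finset.sum_filter]
    refine Finset.sum_congr rfl fun t ht => ?_
    rw [smul_eq_mul, homogeneousComponent_mul_of_isHomogeneous (hB t (hlP t ht))]

theorem exists_isLift {n : ℕ} (lam : YoungDiagram) (j : ℕ) {mu : YoungDiagram} {D : ℕ}
    {f : MvPolynomial (Fin n) ℤ} (hf : f ∈ griffinIdeal ℤ n mu ⊤) (hD : f.IsHomogeneous D) :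
    ∃ F, IsLift n lam j mu D f F := by
  have hspan : griffinIdeal ℤ n mu ⊤ =
      Ideal.span ((fun t : ℕ × Finset (Fin n) => e ℤ t.1 t.2) ''
        {t | IsGeneratorIndex n mu t.1 t.2}) := by
    rw [griffinIdeal]
    congr 1
    ext p
    constructor
    · rintro (⟨d, S, h, rfl⟩ | ⟨k, i, h, -⟩)
      · exact ⟨(d, S), h, rfl⟩
      · exact absurd h.symm (ENat.natCast_ne_top k)
    · rintro ⟨t, h, rfl⟩
      exact Or.inl ⟨t.1, t.2, h, rfl⟩
  rw [hspan] at hf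
  obtain ⟨T, g, hT, h⟩ := exists_homogeneousComponent_eq_sum (d := fun t => t.1)
    (fun t _ => isHomogeneous_e t.1 t.2) hf D
  rw [homogeneousComponent_eq_self hD] at h
  exact ⟨_, T, g, hT, h, rfl⟩

/-! ### Leading monomials -/

open scoped MonomialOrder in
theorem degree_eq_of_forall_le {σ R : Type*} [CommSemiring R] (m : MonomialOrder σ)
    {f : MvPolynomial σ R} {c : σ →₀ ℕ} (h0 : f.coeff c ≠ 0)
    (h : ∀ b, f.coeff b ≠ 0 → b ≼[m] c) : m.degree f = c :=
  m.toSyn.injective (le_antisymm (m.degree_le_iff.2 fun b hb => h b (mem_support_iff.1 hb))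
    (m.le_degree (mem_support_iff.2 h0)))

theorem degree_eq_sum_of_fin {n : ℕ} (c : Fin n →₀ ℕ) : c.degree = ∑ i, c i :=
  Finsupp.degree_eq_sum c

theorem finSuccEquiv_rename_succ {R : Type*} [CommSemiring R] {n : ℕ}
    (f : MvPolynomial (Fin n) R) :
    finSuccEquiv R n (rename Fin.succ f) = Polynomial.C f := by
  induction f using MvPolynomial.induction_on with
  | C a => simp [finSuccEquiv_apply]
  | add p q hp hq => rw [map_add, map_add, hp, hq, Polynomial.C_add]
  | mul_X p i hp => rw [map_mul, map_mul, hp, rename_X, finSuccEquiv_X_succ, Polynomial.C_mul]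

/-- Multiplying by a power of the smallest variable and changing terms divisible by a higher power
of it. -/
theorem degree_lift {n a D : ℕ} {f : MvPolynomial (Fin n) ℤ} {F h : MvPolynomial (Fin (n + 1)) ℤ}
    {β : Fin n →₀ ℕ} (hF : F.IsHomogeneous D)
    (hFf : F = X 0 ^ a * (rename Fin.succ f + X 0 * h))
    (hβ : (grevlex n).degree f = β) (h1 : (grevlex n).leadingCoeff f = 1) :
    (grevlex (n + 1)).degree F = β.cons a ∧ (grevlex (n + 1)).leadingCoeff F = 1 := by
  have hcoeff : ∀ (c : Fin n →₀ ℕ), F.coeff (c.cons a) = f.coeff c := by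
    intro c
    rw [← finSuccEquiv_coeff_coeff, hFf]
    simp [finSuccEquiv_rename_succ, finSuccEquiv_X_zero, Polynomial.coeff_X_pow_mul']
  have hlow : ∀ (i : ℕ) (c : Fin n →₀ ℕ), i < a → F.coeff (c.cons i) = 0 := by
    intro i c hi
    rw [← finSuccEquiv_coeff_coeff, hFf]
    simp [finSuccEquiv_X_zero, Polynomial.coeff_X_pow_mul', hi.not_ge]
  have hlead : F.coeff (β.cons a) = 1 := by
    rw [hcoeff, ← hβ]
    exact h1
  have hdeg : (grevlex (n + 1)).degree F = β.cons a := by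
    refine degree_eq_of_forall_le _ (by rw [hlead]; exact one_ne_zero) fun b hb => ?_
    rw [← Finsupp.cons_tail b] at hb ⊢
    set i := b 0
    set c := b.tail
    -- By homogeneity only the least differing index matters: exponents of `x₁` below `a` do not
    -- occur, exponents above `a` lose, and exponent `a` reduces to `f`.
    have hd : (c.cons i).degree = (β.cons a).degree := by
      rw [not_ne_iff.1 (mt (hF.coeff_eq_zero) hb),
        not_ne_iff.1 (mt (hF.coeff_eq_zero) (hlead.trans_ne one_ne_zero))]
    rcases lt_trichotomy i a with hi | hi | hi
    · exact absurd (hlow i c hi) hb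
    · rw [hi] at hb hd ⊢
      rw [hcoeff] at hb
      rcases eq_or_ne c β with hc | hc
      · rw [hc]
      have hle := (grevlex n).le_degree (mem_support_iff.2 hb)
      rw [hβ] at hle
      have hlt := lt_of_le_of_ne hle (fun h => hc ((grevlex n).toSyn.injective h))
      rw [grevlex_lt_iff] at hlt
      rw [degree_eq_sum_of_fin, degree_eq_sum_of_fin, Fin.sum_univ_succ, Fin.sum_univ_succ] at hd
      simp only [Finsupp.cons_zero, Finsupp.cons_succ] at hd
      rw [degree_eq_sum_of_fin, degree_eq_sum_of_fin] at hlt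
      obtain ⟨k, hk1, hk2⟩ := (hlt.resolve_left (by omega)).2
      refine le_of_lt ((grevlex_lt_iff _ _).2 (Or.inr ⟨?_, k.succ, fun l hl => ?_, ?_⟩))
      · rw [degree_eq_sum_of_fin, degree_eq_sum_of_fin, Fin.sum_univ_succ, Fin.sum_univ_succ]
        simpa only [Finsupp.cons_zero, Finsupp.cons_succ] using hd
      · induction l using Fin.cases with
        | zero => rw [Finsupp.cons_zero, Finsupp.cons_zero]
        | succ l =>
          rw [Finsupp.cons_succ, Finsupp.cons_succ]
          exact hk1 l (Fin.succ_lt_succ_iff.1 hl)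
      · rwa [Finsupp.cons_succ, Finsupp.cons_succ]
    · refine le_of_lt ((grevlex_lt_iff _ _).2 (Or.inr ⟨hd, 0, fun l hl => ?_, ?_⟩))
      · exact absurd hl (Fin.not_lt_zero _)
      · rwa [Finsupp.cons_zero, Finsupp.cons_zero]
  exact ⟨hdeg, by rw [MonomialOrder.leadingCoeff, hdeg, hlead]⟩

/-! ### The recursive construction -/

theorem apply_zero_of_card_eq_one {lam : YoungDiagram} (h : lam.card = 1) {α : Fin 1 → ℕ}
    (hα : α ∈ codeSet 1 lam) : α 0 = 1 := by
  obtain ⟨j, mu, hmu, h0, ht⟩ := exists_tail_mem_codeSet hα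
  cases j with
  | succ r =>
    have := hmu.card
    have := card_pos_of_mem_codeSet ht
    omega
  | zero =>
    have h1 : lam.colLen 0 ≤ 1 := by
      rw [← h, YoungDiagram.colLen_eq_card]
      exact Finset.card_le_card (Finset.filter_subset _ _)
    have h2 : 0 < lam.colLen 0 := YoungDiagram.mem_iff_lt_colLen.1 (mem_of_card_pos h.ge)
    omega

theorem apply_zero_of_card_eq_two {lam : YoungDiagram} (h : lam.card = 2) {α : Fin 1 → ℕ}
    (hα : α ∈ codeSet 1 lam) : α 0 = 0 := by
  obtain ⟨j, mu, hmu, h0, ht⟩ := exists_tail_mem_codeSet hα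
  cases j with
  | zero =>
    rw [hmu.eq_of_zero] at ht
    have := card_le_of_mem_codeSet ht
    omega
  | succ r =>
    rw [h0]
    by_contra hne
    have e1 := hmu r
    have e2 := hmu (r + 1)
    rw [if_pos rfl] at e1
    rw [if_neg (by omega)] at e2
    have := mu.colLen_anti r (r + 1) (by omega)
    -- A nonzero entry means that column `r + 1` is nonempty; column `r`, still at least as long
    -- after losing a box, then has two boxes. This exceeds size two.
    have hsub : ({(0, r), (1, r), (0, r + 1)} : Finset (ℕ × ℕ)) ⊆ lam.cells := by
      intro b hb
      rw [YoungDiagram.mem_cells]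
      simp only [Finset.mem_insert, Finset.mem_singleton] at hb
      rcases hb with rfl | rfl | rfl <;> rw [YoungDiagram.mem_iff_lt_colLen] <;> omega
    have hc := Finset.card_le_card hsub
    rw [Finset.card_insert_of_notMem (by simp), Finset.card_pair (by simp)] at hc
    rw [YoungDiagram.card] at h
    omega

/-! ### Counting boxes by columns and by rows -/

theorem card_filter_eq_sum_colLen (lam : YoungDiagram) (q : ℕ) :
    (lam.cells.filter fun b => q ≤ b.2).card = ∑ i ∈ Finset.Ico q (lam.rowLen 0), lam.colLen i := by
  rw [Finset.card_eq_sum_card_fiberwise (f := Prod.snd) (t := Finset.Ico q (lam.rowLen 0))]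
  · refine Finset.sum_congr rfl fun i hi => ?_
    rw [Finset.mem_Ico] at hi
    rw [YoungDiagram.colLen_eq_card]
    congr 1
    ext b
    simp only [Finset.mem_filter, YoungDiagram.mem_cells, YoungDiagram.mem_col_iff]
    constructor
    · exact fun h => ⟨h.1.1, h.2⟩
    · rintro ⟨h, rfl⟩
      exact ⟨⟨h, hi.1⟩, rfl⟩
  · rintro ⟨x, y⟩ hb
    rw [Finset.mem_coe, Finset.mem_filter, YoungDiagram.mem_cells,
      YoungDiagram.mem_iff_lt_rowLen] at hb
    exact Finset.mem_coe.2 (Finset.mem_Ico.2 ⟨hb.2, hb.1.trans_le (lam.rowLen_anti 0 x (by omega))⟩)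

theorem card_filter_eq_sum_rowLen (lam : YoungDiagram) (q : ℕ) {s : ℕ} (hs : lam.colLen 0 ≤ s) :
    (lam.cells.filter fun b => q ≤ b.2).card = ∑ k : Fin s, (lam.rowLen k - q) := by
  rw [Fin.sum_univ_eq_sum_range (fun k => lam.rowLen k - q),
    Finset.card_eq_sum_card_fiberwise (f := Prod.fst) (t := Finset.range s)]
  · refine Finset.sum_congr rfl fun k _ => ?_
    have h : ((lam.cells.filter fun b => q ≤ b.2).filter fun b => b.1 = k) =
        {k} ×ˢ Finset.Ico q (lam.rowLen k) := by
      ext ⟨x, y⟩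
      simp only [Finset.mem_filter, YoungDiagram.mem_cells, YoungDiagram.mem_iff_lt_rowLen,
        Finset.mem_product, Finset.mem_singleton, Finset.mem_Ico]
      constructor
      · rintro ⟨⟨h1, h2⟩, rfl⟩
        exact ⟨rfl, h2, h1⟩
      · rintro ⟨rfl, h2, h1⟩
        exact ⟨⟨h1, h2⟩, rfl⟩
    rw [h, Finset.card_product, Finset.card_singleton, one_mul, Nat.card_Ico]
  · rintro ⟨x, y⟩ hb
    rw [Finset.mem_coe, Finset.mem_filter, YoungDiagram.mem_cells,
      YoungDiagram.mem_iff_lt_colLen] at hb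
    exact Finset.mem_coe.2 (Finset.mem_range.2
      ((hb.1.trans_le (lam.colLen_anti 0 y (by omega))).trans_le hs))

theorem pSum_self (n : ℕ) (lam : YoungDiagram) : pSum n n lam = lam.card := by
  rw [pSum, Nat.sub_self, ← card_filter_eq_sum_colLen, Finset.filter_true_of_mem fun _ _ =>
    Nat.zero_le _]

/-! ### Base cases, existence of a family, and its leading terms -/

theorem one_mem_griffinIdeal {R : Type*} [CommRing R] {n : ℕ} {lam : YoungDiagram}
    (h : n < lam.card) (s : ℕ∞) : (1 : MvPolynomial (Fin n) R) ∈ griffinIdeal R n lam s := by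
  rw [← e_zero Finset.univ]
  refine e_mem_griffinIdeal ?_ s
  rw [IsGeneratorIndex, Finset.card_univ, Fintype.card_fin, pSum_self]
  omega

theorem X_zero_mem_griffinIdeal {lam : YoungDiagram} (h : lam.card = 1) :
    (X 0 : MvPolynomial (Fin 1) ℤ) ∈ griffinIdeal ℤ 1 lam ⊤ := by
  have h1 : (X 0 : MvPolynomial (Fin 1) ℤ) = e ℤ 1 Finset.univ := by
    simp [e, Finset.powersetCard_one]
  rw [h1]
  refine e_mem_griffinIdeal ?_ _
  rw [IsGeneratorIndex, Finset.card_univ, Fintype.card_fin, pSum_self, h]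
  norm_num

open Classical in
/-- A family produced by the recursive construction. -/
noncomputable def recursiveFamily :
    (n : ℕ) → YoungDiagram → (Fin n → ℕ) → MvPolynomial (Fin n) ℤ
  | 0, _, _ => 0
  | n + 1, lam, α =>
    if n = 0 then if lam.card = 1 then X 0 else 1
    else if h : ∃ F j mu, IsLowered lam j mu ∧ α 0 = lam.colLen j ∧ Fin.tail α ∈ codeSet n mu ∧
        IsLift n lam j mu (∑ i, Fin.tail α i) (recursiveFamily n mu (Fin.tail α)) F then
      h.choose
    else 0

theorem recursiveFamily_one (lam : YoungDiagram) (α : Fin 1 → ℕ) :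
    recursiveFamily 1 lam α = if lam.card = 1 then X 0 else 1 := by
  rw [recursiveFamily, if_pos rfl]

theorem card_eq_of_mem_codeSet_one {lam : YoungDiagram} {α : Fin 1 → ℕ} (hα : α ∈ codeSet 1 lam) :
    lam.card = 1 ∨ lam.card = 2 := by
  have := card_pos_of_mem_codeSet hα
  have := card_le_of_mem_codeSet hα
  omega

/-- On codes the default value `0` is never taken: membership and homogeneity of the smaller
polynomials are exactly what makes a lift exist. -/
theorem recursiveFamily_succ {n : ℕ} (hn : 1 ≤ n)
    (ih : ∀ lam, ∀ α ∈ codeSet n lam, recursiveFamily n lam α ∈ griffinIdeal ℤ n lam ⊤ ∧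
      (recursiveFamily n lam α).IsHomogeneous (∑ i, α i))
    {lam : YoungDiagram} {α : Fin (n + 1) → ℕ} (hα : α ∈ codeSet (n + 1) lam) :
    ∃ j mu, IsLowered lam j mu ∧ α 0 = lam.colLen j ∧ Fin.tail α ∈ codeSet n mu ∧
      IsLift n lam j mu (∑ i, Fin.tail α i) (recursiveFamily n mu (Fin.tail α))
        (recursiveFamily (n + 1) lam α) := by
  have h : ∃ F j mu, IsLowered lam j mu ∧ α 0 = lam.colLen j ∧ Fin.tail α ∈ codeSet n mu ∧
      IsLift n lam j mu (∑ i, Fin.tail α i) (recursiveFamily n mu (Fin.tail α)) F := by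
    obtain ⟨j, mu, hmu, h0, ht⟩ := exists_tail_mem_codeSet hα
    obtain ⟨F, hF⟩ := exists_isLift lam j (ih mu _ ht).1 (ih mu _ ht).2
    exact ⟨F, j, mu, hmu, h0, ht, hF⟩
  have h1 : recursiveFamily (n + 1) lam α = h.choose := by
    rw [recursiveFamily, if_neg (by omega), dif_pos h]
  rw [h1]
  exact h.choose_spec

theorem IsLift.isHomogeneous_of_tail {n j : ℕ} {lam mu : YoungDiagram} {α : Fin (n + 1) → ℕ}
    {f : MvPolynomial (Fin n) ℤ} {F : MvPolynomial (Fin (n + 1)) ℤ} (h0 : α 0 = lam.colLen j)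
    (hF : IsLift n lam j mu (∑ i, Fin.tail α i) f F) : F.IsHomogeneous (∑ i, α i) := by
  rw [Fin.sum_univ_succ, h0]
  exact hF.isHomogeneous

theorem recursiveFamily_spec {n : ℕ} (hn : 1 ≤ n) {lam : YoungDiagram} {α : Fin n → ℕ}
    (hα : α ∈ codeSet n lam) : recursiveFamily n lam α ∈ griffinIdeal ℤ n lam ⊤ ∧
      (recursiveFamily n lam α).IsHomogeneous (∑ i, α i) := by
  induction n, hn using Nat.le_induction generalizing lam with
  | base =>
    rw [recursiveFamily_one]
    rcases card_eq_of_mem_codeSet_one hα with h | h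
    · rw [if_pos h, Fin.sum_univ_one, apply_zero_of_card_eq_one h hα]
      exact ⟨X_zero_mem_griffinIdeal h, isHomogeneous_X _ _⟩
    · rw [if_neg (by omega), Fin.sum_univ_one, apply_zero_of_card_eq_two h hα]
      exact ⟨one_mem_griffinIdeal (by omega) _, isHomogeneous_one _ _⟩
  | succ n hn ih =>
    obtain ⟨j, mu, hmu, h0, ht, hF⟩ := recursiveFamily_succ hn (fun lam α hα => ih hα) hα
    exact ⟨hF.mem hmu, hF.isHomogeneous_of_tail h0⟩

theorem isRecursiveFamily_recursiveFamily : IsRecursiveFamily recursiveFamily where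
  base_one lam h α _ := by rw [recursiveFamily_one, if_pos h]
  base_two lam h α _ := by rw [recursiveFamily_one, if_neg (by omega)]
  step n hn lam _ _ α hα := by
    obtain ⟨j, mu, hmu, h0, ht, hF⟩ :=
      recursiveFamily_succ hn (fun lam α hα => recursiveFamily_spec hn hα) hα
    refine ⟨j, mu, hmu, ?_, h0, ht, hF⟩
    -- With `j = 0` the diagram keeps `n + 2` boxes, too many for `n` numbers and one empty box.
    rintro ⟨rfl, h⟩
    rw [hmu.eq_of_zero] at ht
    have := card_le_of_mem_codeSet ht
    omega

theorem IsRecursiveFamily.spec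
    {G : (n : ℕ) → YoungDiagram → (Fin n → ℕ) → MvPolynomial (Fin n) ℤ}
    (hG : IsRecursiveFamily G) {n : ℕ} (hn : 1 ≤ n) {lam : YoungDiagram} {α : Fin n → ℕ}
    (hα : α ∈ codeSet n lam) :
    G n lam α ∈ griffinIdeal ℤ n lam ⊤ ∧ (G n lam α).IsHomogeneous (∑ i, α i) ∧
      (grevlex n).degree (G n lam α) = Finsupp.equivFunOnFinite.symm α ∧
      (grevlex n).leadingCoeff (G n lam α) = 1 := by
  induction n, hn using Nat.le_induction generalizing lam with
  | base =>
    rcases card_eq_of_mem_codeSet_one hα with h | h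
    · rw [hG.base_one lam h α hα, Fin.sum_univ_one, apply_zero_of_card_eq_one h hα]
      refine ⟨X_zero_mem_griffinIdeal h, isHomogeneous_X _ _, ?_, (grevlex 1).leadingCoeff_X⟩
      rw [MonomialOrder.degree_X]
      refine Finsupp.ext fun i => ?_
      rw [Subsingleton.elim i 0, Finsupp.single_eq_same]
      exact (apply_zero_of_card_eq_one h hα).symm
    · rw [hG.base_two lam h α hα, Fin.sum_univ_one, apply_zero_of_card_eq_two h hα]
      refine ⟨one_mem_griffinIdeal (by omega) _, isHomogeneous_one _ _, ?_,
        (grevlex 1).leadingCoeff_one⟩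
      rw [MonomialOrder.degree_one]
      refine Finsupp.ext fun i => ?_
      rw [Subsingleton.elim i 0]
      exact (apply_zero_of_card_eq_two h hα).symm
  | succ n hn ih =>
    obtain ⟨j, mu, hmu, -, h0, ht, hF⟩ := hG.step n hn lam (card_pos_of_mem_codeSet hα)
      (card_le_of_mem_codeSet hα) α hα
    have hhom := hF.isHomogeneous_of_tail h0
    obtain ⟨h, hFf⟩ := hF.exists_eq
    obtain ⟨-, -, hβ, h1⟩ := ih ht
    obtain ⟨hd, hl⟩ := degree_lift hhom hFf hβ h1
    refine ⟨hF.mem hmu, hhom, hd.trans ?_, hl⟩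
    ext i
    induction i using Fin.cases with
    | zero => exact h0.symm
    | succ i => rfl

/-! ### Counting standard monomials -/

open Classical in
/-- The exponent vectors with entries less than `s` that lie above no element of `D_{n,λ}`. -/
noncomputable def standardExponents (n : ℕ) (lam : YoungDiagram) (s : ℕ) :
    Finset (Fin n → Fin s) :=
  Finset.univ.filter fun β => ∀ α ∈ codeSet n lam, ¬ ∀ i, α i ≤ β i

/-- The maps `[n] → [s]` whose fibre over `k` has at least `λ_k` elements, for all `k`. -/
def thickMaps (n : ℕ) (lam : YoungDiagram) (s : ℕ) : Finset (Fin n → Fin s) :=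
  Finset.univ.filter fun p => ∀ k : Fin s, lam.rowLen k ≤ (Finset.univ.filter (p · = k)).card

theorem mem_standardExponents {n : ℕ} {lam : YoungDiagram} {s : ℕ} {β : Fin n → Fin s} :
    β ∈ standardExponents n lam s ↔ ∀ α ∈ codeSet n lam, ¬ ∀ i, α i ≤ β i := by
  simp [standardExponents]

theorem mem_thickMaps {n : ℕ} {lam : YoungDiagram} {s : ℕ} {p : Fin n → Fin s} :
    p ∈ thickMaps n lam s ↔
      ∀ k : Fin s, lam.rowLen k ≤ (Finset.univ.filter (p · = k)).card := by
  simp [thickMaps]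

theorem card_eq_sum_card_cons {n s : ℕ} (A : Finset (Fin (n + 1) → Fin s)) :
    A.card = ∑ a, (Finset.univ.filter fun β : Fin n → Fin s =>
      (Fin.cons a β : Fin (n + 1) → Fin s) ∈ A).card := by
  classical
  rw [Finset.card_eq_sum_card_fiberwise (f := fun β => β 0) (t := Finset.univ)
    (fun _ _ => Finset.mem_coe.2 (Finset.mem_univ _))]
  refine Finset.sum_congr rfl fun a _ => ?_
  symm
  refine Finset.card_bij (fun β _ => Fin.cons a β) ?_ ?_ ?_
  · intro β hβ
    rw [Finset.mem_filter] at hβ ⊢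
    exact ⟨hβ.2, Fin.cons_zero _ _⟩
  · intro β _ β' _ h
    exact Fin.cons_right_injective (α := fun _ => Fin s) a h
  · intro β hβ
    rw [Finset.mem_filter] at hβ
    have h : (Fin.cons a (Fin.tail β) : Fin (n + 1) → Fin s) = β := by
      rw [← hβ.2]
      exact Fin.cons_self_tail β
    exact ⟨Fin.tail β, Finset.mem_filter.2 ⟨Finset.mem_univ _, by rw [h]; exact hβ.1⟩, h⟩

theorem standardExponents_eq_empty {n : ℕ} {lam : YoungDiagram} (h : lam.card = n + 1) (s : ℕ) :
    standardExponents n lam s = ∅ := by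
  refine Finset.eq_empty_of_forall_notMem fun β hβ => ?_
  exact mem_standardExponents.1 hβ 0 (zero_mem_codeSet h) fun i => Nat.zero_le _

theorem IsLowered.rowLen_eq {lam mu : YoungDiagram} {r : ℕ} (h : IsLowered lam (r + 1) mu) :
    lam.rowLen (mu.colLen r) = r + 1 ∧ mu.rowLen (mu.colLen r) = r ∧
      ∀ x, x ≠ mu.colLen r → lam.rowLen x = mu.rowLen x := by
  have key : ∀ x y, y < lam.rowLen x ↔ y < mu.rowLen x ∨ (x = mu.colLen r ∧ y = r) := by
    intro x y
    have := h.mem_transpose_iff (b := (y, x))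
    rw [YoungDiagram.mem_transpose, YoungDiagram.mem_transpose, Prod.swap_prod_mk,
      YoungDiagram.mem_iff_lt_rowLen, YoungDiagram.mem_iff_lt_rowLen, Prod.mk.injEq] at this
    rw [this, and_comm (a := y = r)]
  have h0 : ¬ r < mu.rowLen (mu.colLen r) := by
    rw [← YoungDiagram.mem_iff_lt_rowLen, YoungDiagram.mem_iff_lt_colLen]
    exact lt_irrefl _
  have h1 := key (mu.colLen r) r
  have h2 := key (mu.colLen r) (r + 1)
  have h3 := key (mu.colLen r) (r - 1)
  refine ⟨by omega, by omega, fun x hx => eq_of_forall_lt_iff fun y => ?_⟩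
  rw [key]
  exact or_iff_left fun h => hx h.1

/-- Removing a box at the end of row `a` gives the rows of a lowered diagram, up to a
transposition. -/
theorem exists_isLowered_rowLen {lam : YoungDiagram} {s : ℕ} (hs : lam.colLen 0 ≤ s) (a : Fin s) :
    ∃ mu, IsLowered lam (lam.rowLen a) mu ∧ ∃ b : Fin s,
      ∀ k : Fin s, lam.rowLen k ≤ (if a = k then 1 else 0) + mu.rowLen (Equiv.swap a b k) := by
  cases hj : lam.rowLen a with
  | zero =>
    refine ⟨lam, isLowered_zero lam, a, fun k => ?_⟩
    rw [Equiv.swap_self, Equiv.refl_apply]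
    exact Nat.le_add_left _ _
  | succ r =>
    have h1 : (a : ℕ) < lam.colLen r := by
      rw [← YoungDiagram.mem_iff_lt_colLen, YoungDiagram.mem_iff_lt_rowLen]
      omega
    have h2 : ¬ (a : ℕ) < lam.colLen (r + 1) := by
      rw [← YoungDiagram.mem_iff_lt_colLen, YoungDiagram.mem_iff_lt_rowLen]
      omega
    obtain ⟨mu, hmu⟩ := exists_isLowered (lam := lam) (r := r) (by omega)
    have hr := hmu r
    rw [if_pos rfl] at hr
    have := lam.colLen_anti 0 r (Nat.zero_le _)
    obtain ⟨e1, e2, e3⟩ := hmu.rowLen_eq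
    -- Only the last row among those as long as row `a` can lose a box. That row is `b`, and
    -- swapping it with `a` moves the loss to `a`.
    refine ⟨mu, hmu, ⟨mu.colLen r, by omega⟩, fun k => ?_⟩
    rcases eq_or_ne k a with rfl | hka
    · rw [Equiv.swap_apply_left, if_pos rfl, hj, e2, add_comm]
    · rw [if_neg hka.symm, zero_add]
      by_cases hkb : (k : ℕ) = mu.colLen r
      · have hk : k = ⟨mu.colLen r, by omega⟩ := Fin.ext hkb
        rw [← hk, Equiv.swap_apply_right, hkb, e1, ← e3 a (fun h => hka (Fin.ext (hkb.trans h.symm))), hj]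
      · rw [Equiv.swap_apply_of_ne_of_ne hka (fun h => hkb (congrArg Fin.val h)), e3 k hkb]

theorem card_filter_cons_eq {n s : ℕ} (a k : Fin s) (p : Fin n → Fin s) :
    (Finset.univ.filter ((Fin.cons a p : Fin (n + 1) → Fin s) · = k)).card =
      (if a = k then 1 else 0) + (Finset.univ.filter (p · = k)).card := by
  rw [Finset.card_filter, Fin.sum_univ_succ, Finset.card_filter]
  simp only [Fin.cons_zero, Fin.cons_succ]

/-- Both sets are sliced by the first coordinate `a`, and `λ` is lowered at `j = lam.rowLen a`.
Standard tails for `λ` are standard for `λ^{(j)}`, while thick maps for `λ^{(j)}`, relabelled by a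
transposition and preceded by `a`, are thick for `λ`. -/
theorem card_standardExponents_le (n : ℕ) (lam : YoungDiagram) (h : lam.card ≤ n + 1) {s : ℕ}
    (hs : lam.colLen 0 ≤ s) : (standardExponents n lam s).card ≤ (thickMaps n lam s).card := by
  induction n generalizing lam with
  | zero =>
    rcases Nat.le_one_iff_eq_zero_or_eq_one.1 h with h0 | h1
    · have hr : ∀ k, lam.rowLen k = 0 := by
        intro k
        by_contra hne
        have := YoungDiagram.mem_iff_lt_rowLen.2 (Nat.pos_of_ne_zero hne)
        exact absurd (Finset.card_pos.2 ⟨_, (YoungDiagram.mem_cells _).2 this⟩) (by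
          rw [YoungDiagram.card] at h0
          omega)
      refine Finset.card_le_card fun β _ => mem_thickMaps.2 fun k => ?_
      rw [hr]
      exact Nat.zero_le _
    · rw [standardExponents_eq_empty h1]
      exact Nat.zero_le _
  | succ n ih =>
    rcases h.eq_or_lt with h | h
    · rw [standardExponents_eq_empty h]
      exact Nat.zero_le _
    rw [card_eq_sum_card_cons, card_eq_sum_card_cons]
    refine Finset.sum_le_sum fun a _ => ?_
    obtain ⟨mu, hmu, b, hb⟩ := exists_isLowered_rowLen hs a
    have hcard : mu.card ≤ n + 1 := by
      cases hj : lam.rowLen a with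
      | zero =>
        rw [hj] at hmu
        rw [hmu.eq_of_zero]
        omega
      | succ r =>
        rw [hj] at hmu
        have := hmu.card
        omega
    -- Rows longer than row `a` precede it. So a code below the tail, preceded by `lam.colLen j`,
    -- stays below the whole exponent vector.
    have hle : lam.colLen (lam.rowLen a) ≤ a := by
      by_contra! hlt
      rw [← YoungDiagram.mem_iff_lt_colLen, YoungDiagram.mem_iff_lt_rowLen] at hlt
      exact lt_irrefl _ hlt
    refine (Finset.card_le_card ?_).trans
      ((ih mu hcard ((hmu.colLen_le 0).trans hs)).trans ?_)
    · intro β hβ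
      rw [Finset.mem_filter, mem_standardExponents] at hβ
      refine mem_standardExponents.2 fun α hα hαβ => hβ.2 _ (cons_mem_codeSet hmu hα) fun i => ?_
      induction i using Fin.cases with
      | zero => rwa [Fin.cons_zero, Fin.cons_zero]
      | succ i =>
        rw [Fin.cons_succ, Fin.cons_succ]
        exact hαβ i
    · refine Finset.card_le_card_of_injOn (fun p => Equiv.swap a b ∘ p) (fun p hp => ?_)
        (fun p _ p' _ h => (Equiv.swap a b).injective.comp_left h)
      rw [Finset.mem_coe, mem_thickMaps] at hp
      rw [Finset.mem_coe, Finset.mem_filter, mem_thickMaps]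
      refine ⟨Finset.mem_univ _, fun k => (hb k).trans ?_⟩
      rw [card_filter_cons_eq]
      refine Nat.add_le_add_left ((hp _).trans (Finset.card_le_card fun i hi => ?_)) _
      rw [Finset.mem_filter] at hi ⊢
      refine ⟨hi.1, ?_⟩
      change Equiv.swap a b (p i) = k
      rw [hi.2, Equiv.swap_apply_self]

/-! ### Point sets whose vanishing ideals have the generators among their top forms -/

/-- `h` vanishes at the integral points that are given by the maps in `thickMaps n λ s`. -/
def VanishesOnThickMaps (n : ℕ) (lam : YoungDiagram) (s : ℕ) (h : MvPolynomial (Fin n) ℚ) : Prop :=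
  ∀ p ∈ thickMaps n lam s, eval (fun i => ((p i : ℕ) : ℚ)) h = 0

/-- `h` agrees with `f` in degrees at least `d`. -/
def AgreesFrom {n : ℕ} (d : ℕ) (h f : MvPolynomial (Fin n) ℚ) : Prop :=
  ∀ c : Fin n →₀ ℕ, d ≤ c.degree → h.coeff c = f.coeff c

theorem eval_e_eq_coeff {n : ℕ} (x : Fin n → ℚ) (d : ℕ) (S : Finset (Fin n)) :
    eval x (e ℚ d S) = (∏ i ∈ S, (1 + Polynomial.C (x i) * Polynomial.X)).coeff d := by
  rw [Finset.prod_one_add, Polynomial.finsetSum_coeff, e, map_sum, Finset.powersetCard_eq_filter,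
    Finset.sum_filter]
  refine Finset.sum_congr rfl fun t _ => ?_
  rw [Finset.prod_mul_distrib, Finset.prod_const, ← map_prod, Polynomial.coeff_C_mul_X_pow,
    map_prod]
  simp only [eval_X, eq_comm]

/-- At most `n - |S|` elements of a fibre lie outside `S`. -/
theorem le_card_filter {n s : ℕ} {lam : YoungDiagram} {p : Fin n → Fin s}
    (hp : p ∈ thickMaps n lam s) (S : Finset (Fin n)) (k : Fin s) :
    lam.rowLen k - (n - S.card) ≤ (S.filter (p · = k)).card := by
  have h1 := mem_thickMaps.1 hp k
  have h2 : Finset.univ.filter (p · = k) ⊆ S.filter (p · = k) ∪ Sᶜ := by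
    intro i hi
    rw [Finset.mem_filter] at hi
    rw [Finset.mem_union, Finset.mem_filter, Finset.mem_compl]
    tauto
  have h3 := (Finset.card_le_card h2).trans (Finset.card_union_le _ _)
  rw [Finset.card_compl, Fintype.card_fin] at h3
  omega

theorem pSum_eq_sum_rowLen (n m : ℕ) {lam : YoungDiagram} {s : ℕ} (hs : lam.colLen 0 ≤ s) :
    pSum n m lam = ∑ k : Fin s, (lam.rowLen k - (n - m)) := by
  rw [pSum, ← card_filter_eq_sum_colLen, card_filter_eq_sum_rowLen lam _ hs]

/-- The coefficient of `t ^ d` in `∏_{i ∈ S} (1 + xᵢ t) / ∏ₖ (1 + k t) ^ max(λₖ - (n - |S|), 0)`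
vanishes at the points and has top form `e_d(S)`. -/
theorem exists_agreesFrom_e {n s d : ℕ} {lam : YoungDiagram} (hs : lam.colLen 0 ≤ s)
    {S : Finset (Fin n)} (hS : IsGeneratorIndex n lam d S) :
    ∃ h, VanishesOnThickMaps n lam s h ∧ AgreesFrom d h (e ℚ d S) := by
  let q : ℕ → Polynomial ℚ := fun k => 1 + Polynomial.C (k : ℚ) * Polynomial.X
  let μ : Fin s → ℕ := fun k => lam.rowLen k - (n - S.card)
  let B : Polynomial ℚ := ∏ k : Fin s, q k ^ μ k
  have hB0 : PowerSeries.constantCoeff (B : PowerSeries ℚ) = 1 := by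
    simp [B, q, ← PowerSeries.coeff_zero_eq_constantCoeff_apply, Polynomial.coeff_coe,
      Polynomial.coeff_zero_eq_eval_zero, Polynomial.eval_prod]
  have hBinv : (B : PowerSeries ℚ) * (B : PowerSeries ℚ)⁻¹ = 1 :=
    PowerSeries.mul_inv_cancel _ (by rw [hB0]; exact one_ne_zero)
  have hc0 : PowerSeries.coeff 0 (B : PowerSeries ℚ)⁻¹ = 1 := by
    rw [PowerSeries.coeff_zero_eq_constantCoeff_apply, PowerSeries.constantCoeff_inv, hB0, inv_one]
  -- `B` does not depend on the point, so this coefficient of the quotient is a polynomial in the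
  -- `e_k(S)`; its top form is `e_d(S)` because `B⁻¹` has constant term `1`.
  refine ⟨∑ kl ∈ Finset.HasAntidiagonal.antidiagonal d,
    C (PowerSeries.coeff kl.2 (B : PowerSeries ℚ)⁻¹) * e ℚ kl.1 S, fun p hp => ?_, fun c hc => ?_⟩
  · set x : Fin n → ℚ := fun i => ((p i : ℕ) : ℚ)
    let ν : Fin s → ℕ := fun k => (S.filter (p · = k)).card
    let Q : Polynomial ℚ := ∏ k : Fin s, q k ^ (ν k - μ k)
    have hμν : ∀ k, μ k ≤ ν k := le_card_filter hp S
    have hE : ∏ i ∈ S, (1 + Polynomial.C (x i) * Polynomial.X) = Q * B := by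
      rw [← Finset.prod_mul_distrib, ← Finset.prod_fiberwise S p]
      refine Finset.prod_congr rfl fun k _ => ?_
      rw [← pow_add, Nat.sub_add_cancel (hμν k)]
      refine Finset.prod_eq_pow_card fun i hi => ?_
      rw [← (Finset.mem_filter.1 hi).2]
    -- At a point of the set, `B` divides the product, and the quotient `Q` has degree at most `|S|
    -- - pSum n |S| λ`. The generator condition says that this is below `d`.
    have hdeg : Q.natDegree < d := by
      have h1 : Q.natDegree ≤ ∑ k, (ν k - μ k) := by
        refine (Polynomial.natDegree_prod_le _ _).trans (Finset.sum_le_sum fun k _ => ?_)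
        refine Polynomial.natDegree_pow_le.trans ?_
        have : (q k).natDegree ≤ 1 := by
          refine (Polynomial.natDegree_add_le _ _).trans (max_le (by simp) ?_)
          exact (Polynomial.natDegree_C_mul_le _ _).trans Polynomial.natDegree_X_le
        exact (Nat.mul_le_mul_left _ this).trans (mul_one _).le
      have h2 : ∑ k, (ν k - μ k) + ∑ k, μ k = ∑ k, ν k := by
        rw [← Finset.sum_add_distrib]
        exact Finset.sum_congr rfl fun k _ => Nat.sub_add_cancel (hμν k)
      have h3 : ∑ k, ν k = S.card :=
        (Finset.card_eq_sum_card_fiberwise fun _ _ => Finset.mem_coe.2 (Finset.mem_univ _)).symm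
      have h4 : pSum n S.card lam = ∑ k, μ k := pSum_eq_sum_rowLen n S.card hs
      rw [IsGeneratorIndex] at hS
      omega
    have hQ : ((∏ i ∈ S, (1 + Polynomial.C (x i) * Polynomial.X) : Polynomial ℚ) : PowerSeries ℚ) *
        (B : PowerSeries ℚ)⁻¹ = Q := by
      rw [hE, Polynomial.coe_mul, mul_assoc, hBinv, mul_one]
    have hcoeff := congrArg (PowerSeries.coeff d) hQ
    rw [PowerSeries.coeff_mul, Polynomial.coeff_coe,
      Polynomial.coeff_eq_zero_of_natDegree_lt hdeg] at hcoeff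
    rw [map_sum, ← hcoeff]
    refine Finset.sum_congr rfl fun kl _ => ?_
    rw [map_mul, eval_C, eval_e_eq_coeff, Polynomial.coeff_coe, mul_comm]
  · rw [coeff_sum, Finset.sum_eq_single (d, 0)]
    · rw [hc0, C_1, one_mul]
    · rintro ⟨k, l⟩ hkl hne
      rw [Finset.HasAntidiagonal.mem_antidiagonal] at hkl
      dsimp only at hkl ⊢
      have hl : l ≠ 0 := by
        rintro rfl
        exact hne (by rw [← hkl, add_zero])
      rw [coeff_C_mul, (isHomogeneous_e k S).coeff_eq_zero (by omega), mul_zero]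
    · intro h
      exact absurd (Finset.HasAntidiagonal.mem_antidiagonal.2 (add_zero d)) h

/-- The product of `xᵢ - k` over `0 ≤ k < s` vanishes, as all coordinates are among these `k`. -/
theorem exists_agreesFrom_X_pow {n s : ℕ} (lam : YoungDiagram) (i : Fin n) :
    ∃ h, VanishesOnThickMaps n lam s h ∧ AgreesFrom s h (X i ^ s) := by
  let P : Polynomial ℚ := ∏ k ∈ Finset.range s, (Polynomial.X - Polynomial.C (k : ℚ))
  have hmonic : P.Monic := Polynomial.monic_prod_of_monic _ _ fun k _ => Polynomial.monic_X_sub_C _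
  have hdeg : P.natDegree = s := by
    rw [Polynomial.natDegree_prod_of_monic _ _ fun k _ => Polynomial.monic_X_sub_C _,
      Finset.sum_congr rfl fun k _ => Polynomial.natDegree_X_sub_C _, Finset.sum_const,
      Finset.card_range, smul_eq_mul, mul_one]
  refine ⟨Polynomial.aeval (X i) P, fun p _ => ?_, fun c hc => ?_⟩
  · rw [map_prod, map_prod]
    refine Finset.prod_eq_zero (Finset.mem_range.2 (p i).isLt) ?_
    simp
  · rw [Polynomial.aeval_eq_sum_range, hdeg, Finset.sum_range_succ, coeff_add, coeff_sum,
      Finset.sum_eq_zero, zero_add]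
    · rw [← hdeg, hmonic.coeff_natDegree, one_smul]
    · intro j hj
      rw [Finset.mem_range] at hj
      rw [coeff_smul, (isHomogeneous_X_pow i j).coeff_eq_zero (by omega), smul_zero]

theorem AgreesFrom.mul {n d k : ℕ} {g h f : MvPolynomial (Fin n) ℚ} (hg : g.IsHomogeneous k)
    (hf : AgreesFrom d h f) : AgreesFrom (k + d) (g * h) (g * f) := by
  intro c hc
  rw [coeff_mul, coeff_mul]
  refine Finset.sum_congr rfl fun uv huv => ?_
  by_cases hu : uv.1.degree = k
  · rw [Finset.HasAntidiagonal.mem_antidiagonal] at huv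
    rw [← huv, map_add] at hc
    rw [hf uv.2 (by omega)]
  · rw [hg.coeff_eq_zero hu, zero_mul, zero_mul]

/-- The leading monomials of `I_{n,λ,s}` are leading monomials of the vanishing ideal. -/
theorem exists_vanishes_degree_eq {n s : ℕ} {lam : YoungDiagram} (hs : lam.colLen 0 ≤ s)
    {f : MvPolynomial (Fin n) ℚ} (hf : f ∈ griffinIdeal ℚ n lam s) (hf0 : f ≠ 0) :
    ∃ h, VanishesOnThickMaps n lam s h ∧ h ≠ 0 ∧ (grevlex n).degree h = (grevlex n).degree f := by
  let P : Set (MvPolynomial (Fin n) ℚ × ℕ) :=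
    {t | t.1.IsHomogeneous t.2 ∧ ∃ h, VanishesOnThickMaps n lam s h ∧ AgreesFrom t.2 h t.1}
  have hsub : griffinIdeal ℚ n lam s ≤ Ideal.span (Prod.fst '' P) := by
    refine Ideal.span_mono ?_
    rintro p (⟨d, S, h, rfl⟩ | ⟨k, i, h, rfl⟩)
    · exact ⟨(_, d), ⟨isHomogeneous_e d S, exists_agreesFrom_e hs h⟩, rfl⟩
    · obtain rfl : s = k := by exact_mod_cast h
      exact ⟨(_, s), ⟨isHomogeneous_X_pow i s, exists_agreesFrom_X_pow lam i⟩, rfl⟩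
  set γ := (grevlex n).degree f
  obtain ⟨T, g, hT, hsum⟩ := exists_homogeneousComponent_eq_sum (B := Prod.fst) (d := Prod.snd)
    (fun t (ht : t ∈ P) => ht.1) (hsub hf) γ.degree
  have hex : ∀ t, ∃ h, t ∈ T → VanishesOnThickMaps n lam s h ∧ AgreesFrom t.2 h t.1 := by
    intro t
    by_cases ht : t ∈ T
    · obtain ⟨h, hh⟩ := (hT t ht).1.2
      exact ⟨h, fun _ => hh⟩
    · exact ⟨0, fun h => absurd h ht⟩
  choose h hh using hex
  -- Replacing each form by a vanishing polynomial with that top form changes only terms of lower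
  -- degree, which are smaller in a graded order.
  have hagree : AgreesFrom γ.degree (∑ t ∈ T, g t * h t) (homogeneousComponent γ.degree f) := by
    intro c hc
    rw [hsum, coeff_sum, coeff_sum]
    refine Finset.sum_congr rfl fun t ht => ?_
    obtain ⟨-, k, hk, hg⟩ := hT t ht
    exact (hh t ht).2.mul hg c (by omega)
  have hγ : (∑ t ∈ T, g t * h t).coeff γ ≠ 0 := by
    rw [hagree γ le_rfl, coeff_homogeneousComponent, if_pos rfl]
    exact mem_support_iff.1 ((grevlex n).degree_mem_support hf0)
  refine ⟨∑ t ∈ T, g t * h t, fun p hp => ?_, fun h0 => hγ (by rw [h0, coeff_zero]),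
    degree_eq_of_forall_le _ hγ fun b hb => ?_⟩
  · rw [map_sum]
    refine Finset.sum_eq_zero fun t ht => ?_
    rw [map_mul, (hh t ht).1 p hp, mul_zero]
  · rcases lt_or_ge b.degree γ.degree with hlt | hge
    · exact le_of_lt ((grevlex_lt_iff _ _).2 (Or.inl hlt))
    · rw [hagree b hge, coeff_homogeneousComponent] at hb
      exact (grevlex n).le_degree (mem_support_iff.2 (ite_ne_right_iff.1 hb).2)

/-! ### The comparison of dimensions -/

/-- Evaluation at the points. -/
noncomputable def evalThickMaps (n : ℕ) (lam : YoungDiagram) (s : ℕ) :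
    MvPolynomial (Fin n) ℚ →ₗ[ℚ] (thickMaps n lam s → ℚ) :=
  LinearMap.pi fun p => (aeval fun i => ((p.1 i : ℕ) : ℚ)).toLinearMap

theorem evalThickMaps_apply {n : ℕ} {lam : YoungDiagram} {s : ℕ} (h : MvPolynomial (Fin n) ℚ)
    (p : thickMaps n lam s) :
    evalThickMaps n lam s h p = eval (fun i => ((p.1 i : ℕ) : ℚ)) h := by
  simp [evalThickMaps, aeval_eq_eval]

/-- Lagrange interpolation on the grid `{0, …, s-1}^n`. -/
theorem evalThickMaps_surjective (n : ℕ) (lam : YoungDiagram) (s : ℕ) :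
    Function.Surjective (evalThickMaps n lam s) := by
  classical
  let L : (Fin n → Fin s) → MvPolynomial (Fin n) ℚ := fun p =>
    ∏ i, ∏ k ∈ Finset.univ.erase (p i),
      C ((((p i : ℕ) : ℚ) - ((k : ℕ) : ℚ))⁻¹) * (X i - C ((k : ℕ) : ℚ))
  have hL : ∀ p q : Fin n → Fin s,
      eval (fun i => ((q i : ℕ) : ℚ)) (L p) = if p = q then 1 else 0 := by
    intro p q
    simp only [L, map_prod, map_mul, map_sub, eval_C, eval_X]
    split_ifs with hpq
    · subst hpq
      refine Finset.prod_eq_one fun i _ => Finset.prod_eq_one fun k hk => ?_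
      refine inv_mul_cancel₀ (sub_ne_zero.2 fun h => ?_)
      exact (Finset.mem_erase.1 hk).1 (Fin.ext (by exact_mod_cast h.symm))
    · obtain ⟨i, hi⟩ := Function.ne_iff.1 hpq
      refine Finset.prod_eq_zero (Finset.mem_univ i) (Finset.prod_eq_zero
        (Finset.mem_erase.2 ⟨hi.symm, Finset.mem_univ (q i)⟩) ?_)
      rw [sub_self, mul_zero]
  intro φ
  refine ⟨∑ p, φ p • L p.1, funext fun q => ?_⟩
  rw [evalThickMaps_apply, map_sum, Finset.sum_eq_single q]
  · rw [smul_eval, hL, if_pos rfl, mul_one]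
  · intro p _ hp
    rw [smul_eval, hL, if_neg (fun h => hp (Subtype.ext h)), mul_zero]
  · exact fun h => absurd (Finset.mem_univ q) h

open scoped MonomialOrder in
/-- Monomials that are not leading monomials of the kernel span the image. -/
theorem map_monomial_mem_span {σ K V : Type*} [Field K] [AddCommGroup V] [Module K V]
    (m : MonomialOrder σ) (ev : MvPolynomial σ K →ₗ[K] V) (A : Set (σ →₀ ℕ))
    (hA : ∀ γ, γ ∉ A → ∃ h, ev h = 0 ∧ h ≠ 0 ∧ m.degree h = γ) (γ : σ →₀ ℕ) :
    ev (monomial γ 1) ∈ Submodule.span K ((fun b => ev (monomial b 1)) '' A) := by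
  classical
  suffices H : ∀ a : m.syn, ∀ γ, m.toSyn γ = a →
      ev (monomial γ 1) ∈ Submodule.span K ((fun b => ev (monomial b 1)) '' A) from H _ γ rfl
  intro a
  induction a using WellFoundedLT.induction with
  | ind a ih =>
    rintro γ rfl
    by_cases hγ : γ ∈ A
    · exact Submodule.subset_span ⟨γ, hγ, rfl⟩
    obtain ⟨h, hev, h0, rfl⟩ := hA γ hγ
    have hmem := m.degree_mem_support h0
    have hmon : ∀ b, monomial b (h.coeff b) = h.coeff b • monomial b (1 : K) := fun b => by
      rw [smul_monomial, smul_eq_mul, mul_one]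
    -- The relation `ev h = 0` expresses the image of the leading monomial through images of smaller
    -- monomials.
    rw [h.as_sum, ← Finset.add_sum_erase _ _ hmem, map_add, map_sum] at hev
    have h1 := eq_neg_of_add_eq_zero_left hev
    rw [hmon, map_smul] at h1
    have hc : h.coeff (m.degree h) ≠ 0 := mem_support_iff.1 hmem
    rw [← inv_smul_smul₀ hc (ev (monomial (m.degree h) 1)), h1]
    refine Submodule.smul_mem _ _ (Submodule.neg_mem _ (Submodule.sum_mem _ fun b hb => ?_))
    rw [hmon, map_smul]
    refine Submodule.smul_mem _ _ (ih (m.toSyn b) ?_ b rfl)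
    rw [Finset.mem_erase] at hb
    exact lt_of_le_of_ne (m.le_degree hb.2) fun h => hb.1 (m.toSyn.injective h)

/-- Every leading monomial of `I_{n,λ,s}` is divisible by some `xᵢ ^ s` or some `x ^ α` with
`α ∈ D_{n,λ}`. -/
theorem exists_le_degree {n s : ℕ} {lam : YoungDiagram} (hcard : lam.card ≤ n + 1)
    (hs : lam.colLen 0 ≤ s)
    (hD : ∀ α ∈ codeSet n lam, ∃ F ∈ griffinIdeal ℚ n lam s, F ≠ 0 ∧
      (grevlex n).degree F = Finsupp.equivFunOnFinite.symm α)
    {f : MvPolynomial (Fin n) ℚ} (hf : f ∈ griffinIdeal ℚ n lam s) (hf0 : f ≠ 0) :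
    (∃ i, s ≤ (grevlex n).degree f i) ∨
      ∃ α ∈ codeSet n lam, ∀ i, α i ≤ (grevlex n).degree f i := by
  classical
  by_contra! hcon
  obtain ⟨hlt, hstd⟩ := hcon
  set β₀ := (grevlex n).degree f
  let ι : (Fin n → Fin s) → (Fin n →₀ ℕ) := fun β =>
    Finsupp.equivFunOnFinite.symm fun i => (β i : ℕ)
  let β : Fin n → Fin s := fun i => ⟨β₀ i, hlt i⟩
  have hβ : β ∈ standardExponents n lam s := by
    refine mem_standardExponents.2 fun α hα hle => ?_
    obtain ⟨i, hi⟩ := hstd α hα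
    exact absurd (hle i) (not_le.2 hi)
  -- The exponent of the supposed new leading monomial is itself standard; without it, the remaining
  -- ones still span all functions on the points.
  let A : Finset (Fin n → Fin s) := (standardExponents n lam s).erase β
  have hmul : ∀ F ∈ griffinIdeal ℚ n lam s, F ≠ 0 → ∀ γ, (grevlex n).degree F ≤ γ →
      ∃ h, evalThickMaps n lam s h = 0 ∧ h ≠ 0 ∧ (grevlex n).degree h = γ := by
    intro F hF hF0 γ hγ
    have hm0 : (monomial (γ - (grevlex n).degree F) (1 : ℚ)) ≠ 0 :=
      mt monomial_eq_zero.1 one_ne_zero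
    obtain ⟨h, h1, h2, h3⟩ := exists_vanishes_degree_eq hs
      (Ideal.mul_mem_left _ (monomial (γ - (grevlex n).degree F) 1) hF) (mul_ne_zero hm0 hF0)
    refine ⟨h, funext fun p => ?_, h2, ?_⟩
    · rw [evalThickMaps_apply]
      exact h1 p.1 p.2
    · rw [h3, MonomialOrder.degree_mul hm0 hF0, MonomialOrder.degree_monomial,
        if_neg one_ne_zero, tsub_add_cancel_of_le hγ]
  have hlead : ∀ γ, γ ∉ (A.image ι : Set (Fin n →₀ ℕ)) →
      ∃ h, evalThickMaps n lam s h = 0 ∧ h ≠ 0 ∧ (grevlex n).degree h = γ := by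
    intro γ hγ
    by_cases hγs : ∀ i, γ i < s
    · let δ : Fin n → Fin s := fun i => ⟨γ i, hγs i⟩
      have hδ : ι δ = γ := Finsupp.ext fun i => rfl
      by_cases hδstd : δ ∈ standardExponents n lam s
      · have hδβ : δ = β := by
          by_contra hne
          exact hγ (Finset.mem_coe.2 (Finset.mem_image.2
            ⟨δ, Finset.mem_erase.2 ⟨hne, hδstd⟩, hδ⟩))
        refine hmul f hf hf0 γ (le_of_eq ?_)
        rw [← hδ, hδβ]
        exact Finsupp.ext fun i => rfl
      · rw [mem_standardExponents] at hδstd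
        push Not at hδstd
        obtain ⟨α, hα, hle⟩ := hδstd
        obtain ⟨F, hF, hF0, hFα⟩ := hD α hα
        refine hmul F hF hF0 γ ?_
        rw [hFα]
        exact fun i => hle i
    · push Not at hγs
      obtain ⟨i, hi⟩ := hγs
      refine hmul (X i ^ s) (Ideal.subset_span (Or.inr ⟨s, i, rfl, rfl⟩))
        (pow_ne_zero _ (X_ne_zero i)) γ ?_
      rw [MonomialOrder.degree_pow, MonomialOrder.degree_X, Finsupp.smul_single, smul_eq_mul,
        mul_one]
      exact Finsupp.single_le_iff.2 hi
  have htop : Submodule.span ℚ ((A.image fun b => evalThickMaps n lam s (monomial (ι b) 1) :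
      Finset _) : Set (thickMaps n lam s → ℚ)) = ⊤ := by
    rw [eq_top_iff, ← LinearMap.range_eq_top.2 (evalThickMaps_surjective n lam s)]
    rintro _ ⟨F, rfl⟩
    rw [F.as_sum, map_sum]
    refine Submodule.sum_mem _ fun γ _ => ?_
    rw [show monomial γ (F.coeff γ) = F.coeff γ • monomial γ (1 : ℚ) by
      rw [smul_monomial, smul_eq_mul, mul_one], map_smul]
    have := map_monomial_mem_span (grevlex n) (evalThickMaps n lam s) _ hlead γ
    rw [Finset.coe_image, Set.image_image] at this
    rw [Finset.coe_image]
    exact Submodule.smul_mem _ _ this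
  -- The number of points is at most `A.card`, hence less than the number of standard exponents,
  -- against `card_standardExponents_le`.
  have h1 := finrank_span_finset_le_card (R := ℚ)
    (A.image fun b => evalThickMaps n lam s (monomial (ι b) 1))
  rw [Set.finrank, htop, finrank_top, Module.finrank_fintype_fun_eq_card, Fintype.card_coe] at h1
  have h2 := h1.trans Finset.card_image_le
  have h3 := card_standardExponents_le n lam hcard hs
  have h4 := Finset.card_erase_lt_of_mem hβ
  exact absurd (h3.trans h2) (not_le.2 h4)

/-! ### Gröbner bases -/

theorem leadingIdeal_eq_of_forall_exists_le {σ K : Type*} [Field K] (m : MonomialOrder σ)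
    {A : Set (MvPolynomial σ K)} {I : Ideal (MvPolynomial σ K)} (hA : A ⊆ I)
    (h : ∀ f ∈ I, f ≠ 0 → ∃ g ∈ A, g ≠ 0 ∧ m.degree g ≤ m.degree f) :
    leadingIdeal m A = leadingIdeal m (I : Set (MvPolynomial σ K)) := by
  refine le_antisymm (Ideal.span_mono ?_) (Ideal.span_le.2 ?_)
  · rintro p ⟨f, hf, h0, rfl⟩
    exact ⟨f, hA hf, h0, rfl⟩
  · rintro p ⟨f, hf, h0, rfl⟩
    obtain ⟨g, hg, hg0, hle⟩ := h f hf h0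
    have : monomial (m.degree f) (1 : K) =
        monomial (m.degree f - m.degree g) 1 * monomial (m.degree g) 1 := by
      rw [monomial_mul, tsub_add_cancel_of_le hle, mul_one]
    rw [SetLike.mem_coe, this]
    exact Ideal.mul_mem_left _ _ (Ideal.subset_span ⟨g, hg, hg0, rfl⟩)

theorem map_griffinIdeal_le (n : ℕ) (lam : YoungDiagram) (s : ℕ∞) :
    (griffinIdeal ℤ n lam ⊤).map (map (Int.castRingHom ℚ)) ≤ griffinIdeal ℚ n lam s := by
  rw [griffinIdeal, Ideal.map_span, Ideal.span_le]
  rintro _ ⟨p, ⟨d, S, h, rfl⟩ | ⟨k, i, h, -⟩, rfl⟩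
  · rw [map_e]
    exact e_mem_griffinIdeal h s
  · exact absurd h.symm (ENat.natCast_ne_top k)

theorem degree_map_intCast {σ : Type*} (m : MonomialOrder σ) (f : MvPolynomial σ ℤ) :
    m.degree (map (Int.castRingHom ℚ) f) = m.degree f := by
  rw [MonomialOrder.degree, MonomialOrder.degree,
    support_map_of_injective f Int.cast_injective]

theorem griffinIdeal_top_le (n : ℕ) (lam : YoungDiagram) (s : ℕ∞) :
    griffinIdeal ℚ n lam ⊤ ≤ griffinIdeal ℚ n lam s := by
  refine Ideal.span_le.2 ?_
  rintro p (⟨d, S, h, rfl⟩ | ⟨k, i, h, -⟩)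
  · exact e_mem_griffinIdeal h s
  · exact absurd h.symm (ENat.natCast_ne_top k)

section Groebner

variable {G : (n : ℕ) → YoungDiagram → (Fin n → ℕ) → MvPolynomial (Fin n) ℤ} {n : ℕ}
  {lam : YoungDiagram}

theorem IsRecursiveFamily.map_spec (hG : IsRecursiveFamily G) (hn : 1 ≤ n) (s : ℕ∞)
    {α : Fin n → ℕ} (hα : α ∈ codeSet n lam) :
    map (Int.castRingHom ℚ) (G n lam α) ∈ griffinIdeal ℚ n lam s ∧
      map (Int.castRingHom ℚ) (G n lam α) ≠ 0 ∧
      (grevlex n).degree (map (Int.castRingHom ℚ) (G n lam α)) =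
        Finsupp.equivFunOnFinite.symm α := by
  obtain ⟨h1, -, h2, h3⟩ := hG.spec hn hα
  refine ⟨map_griffinIdeal_le n lam s (Ideal.mem_map_of_mem _ h1), fun h0 => ?_, ?_⟩
  · rw [map_eq_zero_iff _ (map_injective _ Int.cast_injective)] at h0
    rw [h0, MonomialOrder.leadingCoeff_zero] at h3
    exact zero_ne_one h3
  · rw [degree_map_intCast, h2]

theorem IsRecursiveFamily.groebnerSet_subset (hG : IsRecursiveFamily G) (hn : 1 ≤ n) (s : ℕ∞) :
    groebnerSet G n lam ⊆ griffinIdeal ℚ n lam s := by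
  rintro _ ⟨α, hα, rfl⟩
  exact (hG.map_spec hn s hα).1

theorem IsRecursiveFamily.exists_le_degree (hG : IsRecursiveFamily G) (hn : 1 ≤ n)
    (hcard : lam.card ≤ n + 1) {s : ℕ} (hs : lam.colLen 0 ≤ s) {f : MvPolynomial (Fin n) ℚ}
    (hf : f ∈ griffinIdeal ℚ n lam s) (hf0 : f ≠ 0) :
    (∃ i, s ≤ (grevlex n).degree f i) ∨
      ∃ g ∈ groebnerSet G n lam, g ≠ 0 ∧ (grevlex n).degree g ≤ (grevlex n).degree f := by
  refine (Griffin.exists_le_degree hcard hs (fun α hα => ⟨_, hG.map_spec hn s hα⟩) hf hf0).imp_right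
    ?_
  rintro ⟨α, hα, hle⟩
  obtain ⟨-, h0, hd⟩ := hG.map_spec hn s hα
  exact ⟨_, ⟨α, hα, rfl⟩, h0, by rw [hd]; exact fun i => hle i⟩

theorem IsRecursiveFamily.isGroebnerBasis_top (hG : IsRecursiveFamily G) (hn : 1 ≤ n)
    (hcard : lam.card ≤ n + 1) :
    IsGroebnerBasis (grevlex n) (groebnerSet G n lam) (griffinIdeal ℚ n lam ⊤) := by
  refine ⟨(finite_codeSet n lam).image _, hG.groebnerSet_subset hn _,
    leadingIdeal_eq_of_forall_exists_le _ (hG.groebnerSet_subset hn _) fun f hf hf0 => ?_⟩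
  -- Beyond the degree of the leading monomial, so that no `xᵢ^s` divides it.
  let s := lam.colLen 0 + ((grevlex n).degree f).degree + 1
  refine (hG.exists_le_degree hn hcard (s := s) (by omega) (griffinIdeal_top_le n lam _ hf)
    hf0).resolve_left ?_
  rintro ⟨i, hi⟩
  have := Finsupp.le_degree i ((grevlex n).degree f)
  omega

theorem IsRecursiveFamily.isGroebnerBasis (hG : IsRecursiveFamily G) (hn : 1 ≤ n)
    (hcard : lam.card ≤ n + 1) {s : ℕ} (hs : lam.colLen 0 ≤ s) :
    IsGroebnerBasis (grevlex n) (groebnerSet G n lam ∪ Set.range fun i : Fin n => X i ^ s)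
      (griffinIdeal ℚ n lam s) := by
  have hsub : groebnerSet G n lam ∪ Set.range (fun i : Fin n => (X i ^ s : MvPolynomial _ ℚ)) ⊆
      griffinIdeal ℚ n lam s := by
    refine Set.union_subset (hG.groebnerSet_subset hn _) ?_
    rintro _ ⟨i, rfl⟩
    exact Ideal.subset_span (Or.inr ⟨s, i, rfl, rfl⟩)
  refine ⟨((finite_codeSet n lam).image _).union (Set.finite_range _), hsub,
    leadingIdeal_eq_of_forall_exists_le _ hsub fun f hf hf0 => ?_⟩
  rcases hG.exists_le_degree hn hcard hs hf hf0 with ⟨i, hi⟩ | ⟨g, hg, h⟩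
  · refine ⟨X i ^ s, Or.inr ⟨i, rfl⟩, pow_ne_zero _ (X_ne_zero i), ?_⟩
    rw [MonomialOrder.degree_pow, MonomialOrder.degree_X, Finsupp.smul_single, smul_eq_mul,
      mul_one]
    exact Finsupp.single_le_iff.2 hi
  · exact ⟨g, Or.inl hg, h⟩

end Groebner

end Griffin

theorem mainTheorem1 :
    (∃ G, Griffin.IsRecursiveFamily G) ∧
    ∀ G, Griffin.IsRecursiveFamily G →
      ∀ (n : ℕ) (lam : YoungDiagram), 1 ≤ n → 1 ≤ lam.card → lam.card ≤ n + 1 →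
        (Griffin.codeSet n lam).Finite ∧
        (∀ α ∈ Griffin.codeSet n lam,
          G n lam α ∈ Griffin.griffinIdeal ℤ n lam ⊤ ∧
          (G n lam α).IsHomogeneous (∑ i, α i) ∧
          (Griffin.grevlex n).degree (G n lam α) = Finsupp.equivFunOnFinite.symm α ∧
          (Griffin.grevlex n).leadingCoeff (G n lam α) = 1) ∧
        Griffin.IsGroebnerBasis (Griffin.grevlex n) (Griffin.groebnerSet G n lam)
          (Griffin.griffinIdeal ℚ n lam ⊤) ∧
        ∀ s : ℕ, lam.colLen 0 ≤ s →
          Griffin.IsGroebnerBasis (Griffin.grevlex n)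
            (Griffin.groebnerSet G n lam ∪ Set.range fun i : Fin n => MvPolynomial.X i ^ s)
            (Griffin.griffinIdeal ℚ n lam s) :=
  ⟨⟨_, Griffin.isRecursiveFamily_recursiveFamily⟩, fun _ hG n lam hn _ hcard =>
    ⟨Griffin.finite_codeSet n lam, fun _ hα => hG.spec hn hα, hG.isGroebnerBasis_top hn hcard,
      fun _ hs => hG.isGroebnerBasis hn hcard hs⟩⟩
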